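/- Let $n\ge 1$ and let $(M,g)$ be a smooth Riemannian manifold of dimension $2n+2$. Let $U\subset M$ be open and let $\mathbf k,\mathbf t,\mathbf x_1,\dots,\mathbf x_n,\mathbf y_1,\dots,\mathbf y_n$ be a smooth $g$-orthonormal frame on $U$. Let $\tau:U\to\mathbb R$ be a smooth function with $\nabla\tau=\mathbf k-\mathbf t$, and let $A_i,B_i,C_i,D_i,E_i,F_i,G_i,H_i,N_i$ ($1\le i\le n$), $L$ and $f$ be smooth functions on the image $\tau(U)\subset\mathbb R$; we use the same letters for their compositions with $\tau$, and a prime denotes the derivative with respect to $\tau$. Assume that on $U$ the brackets $[\mathbf x_i,\mathbf x_j]$, $[\mathbf x_i,\mathbf y_j]$, $[\mathbf y_i,\mathbf y_j]$ vanish for $i\ne j$, and that for all $i$ $$[\mathbf k,\mathbf t]=L(\mathbf k+\mathbf t),\qquad [\mathbf x_i,\mathbf y_i]=N_i(\mathbf k+\mathbf t),$$ $$[\mathbf k,\mathbf x_i]=A_i\mathbf x_i+B_i\mathbf y_i,\qquad [\mathbf k,\mathbf y_i]=C_i\mathbf x_i+D_i\mathbf y_i,$$ $$[\mathbf t,\mathbf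 x_i]=E_i\mathbf x_i+F_i\mathbf y_i,\qquad [\mathbf t,\mathbf y_i]=G_i\mathbf x_i+H_i\mathbf y_i,$$ $$A_i-D_i=F_i+G_i,\qquad B_i+C_i=H_i-E_i,\qquad N_i=A_i+D_i=-(E_i+H_i).$$ Let $J$ be the almost complex structure on $U$ with $J\mathbf k=\mathbf t$, $J\mathbf t=-\mathbf k$, $J\mathbf x_i=\mathbf y_i$, $J\mathbf y_i=-\mathbf x_i$ (so that $(g,J)$ is Kähler on $U$), and put $\omega=g(J\cdot,\cdot)$, $\rho=\mathrm{Ric}(J\cdot,\cdot)$. Let $\lambda\ne 0$ be a real constant. (1) The pair $(g,f(\tau))$ is a gradient Kähler–Ricci skew-soliton on $U$ with constant $\lambda$, that is, $$\rho(a,b)+\tfrac12\big(\nabla df(Ja,b)-\nabla df(Jb,a)\big)=\lambda\,\omega(a,b)\quad\text{for all tangent vectors }a,b$$ (with $f=f(\tau)$), if and only if all the functions $N_i$ are equal to a single function $N$, this $N$ vanishes nowhere on $\tau(U)$, and on $\tau(U)$ $$2L+\sum_{j=1}^n(C_j-H_j+A_j-F_j)=-\frac{\lambda}{N}-f'.$$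 (2) The pair $(g,f(\tau))$ is a gradient (Kähler–)Ricci soliton on $U$ with constant $\lambda$, that is, $\mathrm{Ric}+\nabla df=\lambda g$ on $U$, if and only if the condition of (1) holds and, in addition, at every point of $\tau(U)$ where $f'\ne0$ one has $$f''+Lf'=0,\qquad A_i+E_i=0,\qquad D_i+H_i=0,\qquad B_i+C_i+F_i+G_i=0\qquad(1\le i\le n),$$ and every critical point of $f$ in $\tau(U)$ is degenerate, that is, $f''=0$ wherever $f'=0$. -/

import Mathlib

open Bundle Manifold
open scoped ContDiff

noncomputable section

/-! ### Riemannian geometry: Levi-Civita connection, Hessian, Ricci tensor -/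

section Riemannian

variable {d : ℕ} {M : Type*} [TopologicalSpace M]
  [ChartedSpace (EuclideanSpace ℝ (Fin d)) M] [IsManifold (𝓡 d) ∞ M]
  [RiemannianBundle (fun p : M ↦ TangentSpace (𝓡 d) p)]

/-- The right-hand side of the Koszul formula,
`X g(Y,Z) + Y g(X,Z) - Z g(X,Y) + g([X,Y],Z) - g([X,Z],Y) - g([Y,Z],X)`,
which for the Levi-Civita connection equals `2 g(∇_X Y, Z)`. -/
def koszul (X Y Z : (p : M) → TangentSpace (𝓡 d) p) (p : M) : ℝ :=
  mvfderiv (𝓡 d) (fun q ↦ inner ℝ (Y q) (Z q)) p (X p)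
    + mvfderiv (𝓡 d) (fun q ↦ inner ℝ (X q) (Z q)) p (Y p)
    - mvfderiv (𝓡 d) (fun q ↦ inner ℝ (X q) (Y q)) p (Z p)
    + inner ℝ (VectorField.mlieBracket (𝓡 d) X Y p) (Z p)
    - inner ℝ (VectorField.mlieBracket (𝓡 d) X Z p) (Y p)
    - inner ℝ (VectorField.mlieBracket (𝓡 d) Y Z p) (X p)

/-- An orthonormal basis of the tangent space at `p`. -/
def onb (p : M) : OrthonormalBasis (Fin (Module.finrank ℝ (TangentSpace (𝓡 d) p))) ℝ
    (TangentSpace (𝓡 d) p) :=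
  haveI : FiniteDimensional ℝ (TangentSpace (𝓡 d) p) :=
    inferInstanceAs (FiniteDimensional ℝ (EuclideanSpace ℝ (Fin d)))
  stdOrthonormalBasis ℝ (TangentSpace (𝓡 d) p)

/-- The extension of a tangent vector at `p` to a vector field, smooth near `p`. -/
def extendField {p : M} (v : TangentSpace (𝓡 d) p) : (p : M) → TangentSpace (𝓡 d) p :=
  FiberBundle.extend (EuclideanSpace ℝ (Fin d)) v

/-- The Levi-Civita covariant derivative `∇_X Y`: the vector field determined by
`2 g(∇_X Y, Z) = koszul X Y Z`, written out in an orthonormal basis of each tangent space. -/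
def leviCivita (X Y : (p : M) → TangentSpace (𝓡 d) p) : (p : M) → TangentSpace (𝓡 d) p := fun p ↦
  ∑ a, ((1 / 2 : ℝ) * koszul X Y (extendField (onb p a)) p) • onb p a

/-- The curvature `R(X,Y)Z = ∇_X ∇_Y Z - ∇_Y ∇_X Z - ∇_{[X,Y]} Z`. -/
def curvature (X Y Z : (p : M) → TangentSpace (𝓡 d) p) : (p : M) → TangentSpace (𝓡 d) p := fun p ↦
  leviCivita X (leviCivita Y Z) p - leviCivita Y (leviCivita X Z) p
    - leviCivita (VectorField.mlieBracket (𝓡 d) X Y) Z p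

/-- The Ricci tensor `Ric(u,v)`, the trace of `w ↦ R(w,u)v`. -/
def ricci (p : M) (u v : TangentSpace (𝓡 d) p) : ℝ :=
  ∑ a, inner ℝ (curvature (extendField (onb p a)) (extendField u) (extendField v) p) (onb p a)

/-- The Hessian `∇df(u,v) = d_u d_v f - df(∇_u v)`. -/
def hessian (f : M → ℝ) (p : M) (u v : TangentSpace (𝓡 d) p) : ℝ :=
  mvfderiv (𝓡 d) (fun q ↦ mvfderiv (𝓡 d) f q (extendField v q)) p u
    - mvfderiv (𝓡 d) f p (leviCivita (extendField u) (extendField v) p)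

/-- On `U`, the pair `(g,f)` is a gradient Ricci soliton with constant `lam`:
`Ric + ∇df = lam g`. -/
def IsGradientRicciSolitonOn (U : Set M) (f : M → ℝ) (lam : ℝ) : Prop :=
  ∀ p ∈ U, ∀ u v : TangentSpace (𝓡 d) p,
    ricci p u v + hessian f p u v = lam * inner ℝ u v

/-- On `U`, the pair `(g,f)` is a gradient Kähler-Ricci skew-soliton with constant `lam`, with
respect to the almost complex structure `J`: for the Ricci form `ρ = Ric(J·,·)` and the Kähler form
`ω = g(J·,·)`, one has `ρ(u,v) + (1/2) (∇df(Ju,v) - ∇df(Jv,u)) = lam ω(u,v)`. -/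
def IsGradientKahlerRicciSkewSolitonOn (U : Set M)
    (J : (p : M) → TangentSpace (𝓡 d) p →ₗ[ℝ] TangentSpace (𝓡 d) p)
    (f : M → ℝ) (lam : ℝ) : Prop :=
  ∀ p ∈ U, ∀ u v : TangentSpace (𝓡 d) p,
    ricci p (J p u) v + (1 / 2 : ℝ) * (hessian f p (J p u) v - hessian f p (J p v) u)
      = lam * inner ℝ (J p u) v

end Riemannian

/-! ### The frame ansatz -/

/-- The coefficient functions `A_i, …, H_i, N_i, L` of the ansatz, as functions on `S`. -/
structure FrameCoeffs (n : ℕ) (S : Type*) where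
  (A B C D E F G H N : Fin n → S → ℝ)
  (L : S → ℝ)

/-- Composition of all coefficient functions with a map `τ`. -/
def FrameCoeffs.comp {n : ℕ} {S T : Type*} (c : FrameCoeffs n T) (τ : S → T) :
    FrameCoeffs n S where
  A i := c.A i ∘ τ
  B i := c.B i ∘ τ
  C i := c.C i ∘ τ
  D i := c.D i ∘ τ
  E i := c.E i ∘ τ
  F i := c.F i ∘ τ
  G i := c.G i ∘ τ
  H i := c.H i ∘ τ
  N i := c.N i ∘ τ
  L := c.L ∘ τ

/-- All coefficient functions, here functions of a real variable, are smooth on `S`. -/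
structure FrameCoeffs.SmoothOn {n : ℕ} (c : FrameCoeffs n ℝ) (S : Set ℝ) : Prop where
  A : ∀ i, ContDiffOn ℝ ∞ (c.A i) S
  B : ∀ i, ContDiffOn ℝ ∞ (c.B i) S
  C : ∀ i, ContDiffOn ℝ ∞ (c.C i) S
  D : ∀ i, ContDiffOn ℝ ∞ (c.D i) S
  E : ∀ i, ContDiffOn ℝ ∞ (c.E i) S
  F : ∀ i, ContDiffOn ℝ ∞ (c.F i) S
  G : ∀ i, ContDiffOn ℝ ∞ (c.G i) S
  H : ∀ i, ContDiffOn ℝ ∞ (c.H i) S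
  N : ∀ i, ContDiffOn ℝ ∞ (c.N i) S
  L : ContDiffOn ℝ ∞ c.L S

/-- The vector fields `k, t, x_i, y_i` of a frame in real dimension `2n+2`. -/
structure FrameFields (n : ℕ) (M : Type*) [TopologicalSpace M]
    [ChartedSpace (EuclideanSpace ℝ (Fin (2 * n + 2))) M] where
  (k t : (p : M) → TangentSpace (𝓡 (2 * n + 2)) p)
  (x y : Fin n → (p : M) → TangentSpace (𝓡 (2 * n + 2)) p)

section Ansatz

variable {n : ℕ} {M : Type*} [TopologicalSpace M]
  [ChartedSpace (EuclideanSpace ℝ (Fin (2 * n + 2))) M]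

/-- The frame as an indexed family. -/
def FrameFields.family (e : FrameFields n M) :
    (Fin 2 ⊕ (Fin n ⊕ Fin n)) → (p : M) → TangentSpace (𝓡 (2 * n + 2)) p
  | .inl a => if a = 0 then e.k else e.t
  | .inr (.inl i) => e.x i
  | .inr (.inr i) => e.y i

variable [IsManifold (𝓡 (2 * n + 2)) ∞ M]
  [RiemannianBundle (fun p : M ↦ TangentSpace (𝓡 (2 * n + 2)) p)]

/-- The almost complex structure with `Jk = t`, `Jt = -k`, `Jx_i = y_i`, `Jy_i = -x_i`, extended
linearly (the coefficients of a vector in the orthonormal frame are its inner products with the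
frame fields). -/
def FrameFields.J (e : FrameFields n M) (p : M) :
    TangentSpace (𝓡 (2 * n + 2)) p →ₗ[ℝ] TangentSpace (𝓡 (2 * n + 2)) p :=
  (innerₗ _ (e.k p)).smulRight (e.t p) - (innerₗ _ (e.t p)).smulRight (e.k p)
    + ∑ i, ((innerₗ _ (e.x i p)).smulRight (e.y i p) - (innerₗ _ (e.y i p)).smulRight (e.x i p))

local notation "⁅" X ", " Y "⁆" => VectorField.mlieBracket (𝓡 (2 * n + 2)) X Y

/-- `e` is a smooth orthonormal frame on `U` which satisfies the Lie bracket relations of the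
ansatz with coefficient functions `c`. -/
structure IsKahlerFrameOn (U : Set M) (e : FrameFields n M) (c : FrameCoeffs n M) : Prop where
  smooth : ∀ a, ContMDiffOn (𝓡 (2 * n + 2)) (𝓡 (2 * n + 2)).tangent ∞
    (fun p ↦ (⟨p, e.family a p⟩ : TangentBundle (𝓡 (2 * n + 2)) M)) U
  orthonormal : ∀ p ∈ U, Orthonormal ℝ (fun a ↦ e.family a p)
  lie_xx : ∀ p ∈ U, ∀ i j, i ≠ j → ⁅e.x i, e.x j⁆ p = 0
  lie_xy_ne : ∀ p ∈ U, ∀ i j, i ≠ j → ⁅e.x i, e.y j⁆ p = 0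
  lie_yy : ∀ p ∈ U, ∀ i j, i ≠ j → ⁅e.y i, e.y j⁆ p = 0
  lie_kt : ∀ p ∈ U, ⁅e.k, e.t⁆ p = c.L p • (e.k p + e.t p)
  lie_xy : ∀ p ∈ U, ∀ i, ⁅e.x i, e.y i⁆ p = c.N i p • (e.k p + e.t p)
  lie_kx : ∀ p ∈ U, ∀ i, ⁅e.k, e.x i⁆ p = c.A i p • e.x i p + c.B i p • e.y i p
  lie_ky : ∀ p ∈ U, ∀ i, ⁅e.k, e.y i⁆ p = c.C i p • e.x i p + c.D i p • e.y i p
  lie_tx : ∀ p ∈ U, ∀ i, ⁅e.t, e.x i⁆ p = c.E i p • e.x i p + c.F i p • e.y i p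
  lie_ty : ∀ p ∈ U, ∀ i, ⁅e.t, e.y i⁆ p = c.G i p • e.x i p + c.H i p • e.y i p
  rel_AD : ∀ p ∈ U, ∀ i, c.A i p - c.D i p = c.F i p + c.G i p
  rel_BC : ∀ p ∈ U, ∀ i, c.B i p + c.C i p = c.H i p - c.E i p
  rel_N : ∀ p ∈ U, ∀ i, c.N i p = c.A i p + c.D i p
  rel_N' : ∀ p ∈ U, ∀ i, c.N i p = -(c.E i p + c.H i p)

/-- `τ` is smooth on `U` with `∇τ = k - t`. -/
structure IsTauOn (U : Set M) (e : FrameFields n M) (τ : M → ℝ) : Prop where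
  smooth : ContMDiffOn (𝓡 (2 * n + 2)) 𝓘(ℝ, ℝ) ∞ τ U
  grad : ∀ p ∈ U, ∀ v : TangentSpace (𝓡 (2 * n + 2)) p,
    mvfderiv (𝓡 (2 * n + 2)) τ p v = inner ℝ (e.k p - e.t p) v

end Ansatz

/-- On `S`, all `N_i` equal a single nowhere vanishing function `N`, and
`2L + ∑_j (C_j - H_j + A_j - F_j) = -lam/N - f'`. -/
def SkewSolitonODE {n : ℕ} (c : FrameCoeffs n ℝ) (f : ℝ → ℝ) (lam : ℝ) (S : Set ℝ) : Prop :=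
  ∃ N : ℝ → ℝ, (∀ i, ∀ s ∈ S, c.N i s = N s) ∧
    ∀ s ∈ S, N s ≠ 0 ∧
      2 * c.L s + ∑ j, (c.C j s - c.H j s + c.A j s - c.F j s) = -(lam / N s) - deriv f s

/-- The additional soliton conditions at the points of `S` which are not critical for `f`. -/
def SolitonConditions {n : ℕ} (c : FrameCoeffs n ℝ) (f : ℝ → ℝ) (S : Set ℝ) : Prop :=
  ∀ s ∈ S, deriv f s ≠ 0 →
    deriv (deriv f) s + c.L s * deriv f s = 0 ∧
    ∀ i, c.A i s + c.E i s = 0 ∧ c.D i s + c.H i s = 0 ∧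
      c.B i s + c.C i s + c.F i s + c.G i s = 0

/-- Every critical point of `f` in `S` is degenerate. -/
def CriticalPointsDegenerate (f : ℝ → ℝ) (S : Set ℝ) : Prop :=
  ∀ s ∈ S, deriv f s = 0 → deriv (deriv f) s = 0

end

/-! All brackets of the frame have components that are functions of τ, and k, t, x_i, y_i act on
functions of τ as 1, -1, 0, 0 times d/dτ. So Koszul's formula gives the Levi-Civita connection in
closed form (`gamma`), and the Ricci tensor and the Hessian become polynomial expressions in the
coefficients and their τ-derivatives.

The Jacobi identity simplifies these expressions. It yields N_i' + L N_i = N_i² (`jacobi_kxy`),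
further relations for the derivatives of A_i + E_i, B_i + F_i, C_i + G_i, D_i + H_i, and N_j [k + t,
x_i] = N_j [k + t, y_i] = 0 for i ≠ j (`jacobi_ne`). Writing ψ for the left-hand side of the
displayed equation (`psi`), the Ricci tensor turns out to be diagonal, with eigenvalue ψ' - Lψ on k,
t and -N_i ψ on x_i, y_i (`ricciCoeff_eq_ite`).

The skew-soliton equation only involves the J-invariant part of the Hessian and reads ψ' + f'' - L(ψ
+ f') = λ together with -N_i(ψ + f') = λ for all i. As λ ≠ 0, the second family says exactly that
the N_i agree, do not vanish and satisfy the stated equation. The first equation is then automatic: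
differentiate (ψ + f')N = -λ, substitute N' = N² - LN and cancel N
(`skewEquations_iff_skewSolitonODE`).

The Ricci soliton equation adds the J-invariance of the Hessian. The extra entries are f'' + Lf' and
f' times linear expressions in the coefficients; where f' = 0 only f'' = 0 survives
(`solitonEquations_iff_skewEquations`). -/

noncomputable section

/-! ### The Levi-Civita derivative obtained from Koszul's formula -/

section LeviCivita
open VectorField Filter Topology

variable {d : ℕ} {M : Type*} [TopologicalSpace M]
  [ChartedSpace (EuclideanSpace ℝ (Fin d)) M] [IsManifold (𝓡 d) ∞ M]
  [RiemannianBundle (fun p : M ↦ TangentSpace (𝓡 d) p)]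
  {X X' Y Y' Z : (p : M) → TangentSpace (𝓡 d) p} {f : M → ℝ} {p : M}

set_option linter.unusedSectionVars false

/-- The vector field `X` is differentiable at `p`. -/
abbrev FieldDiffAt (X : (p : M) → TangentSpace (𝓡 d) p) (p : M) : Prop :=
  MDifferentiableAt (𝓡 d) ((𝓡 d).prod 𝓘(ℝ, EuclideanSpace ℝ (Fin d)))
    (fun q ↦ (⟨q, X q⟩ : TotalSpace (EuclideanSpace ℝ (Fin d)) (TangentSpace (𝓡 d) (M := M)))) p

/-- The vector field `X` is smooth on a neighbourhood of `p`. -/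
def SmoothNear (X : (p : M) → TangentSpace (𝓡 d) p) (p : M) : Prop :=
  ∀ᶠ q in 𝓝 p, ContMDiffAt (𝓡 d) ((𝓡 d).prod 𝓘(ℝ, EuclideanSpace ℝ (Fin d))) ∞
    (fun q ↦ (⟨q, X q⟩ : TotalSpace (EuclideanSpace ℝ (Fin d)) (TangentSpace (𝓡 d) (M := M)))) q

theorem koszul_congr (hX : X =ᶠ[𝓝 p] X') (hY : Y =ᶠ[𝓝 p] Y') :
    koszul X Y Z p = koszul X' Y' Z p := by
  have e1 : (fun q ↦ inner ℝ (Y q) (Z q)) =ᶠ[𝓝 p] (fun q ↦ inner ℝ (Y' q) (Z q)) := by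
    filter_upwards [hY] with q hq; rw [hq]
  have e2 : (fun q ↦ inner ℝ (X q) (Z q)) =ᶠ[𝓝 p] (fun q ↦ inner ℝ (X' q) (Z q)) := by
    filter_upwards [hX] with q hq; rw [hq]
  have e3 : (fun q ↦ inner ℝ (X q) (Y q)) =ᶠ[𝓝 p] (fun q ↦ inner ℝ (X' q) (Y' q)) := by
    filter_upwards [hX, hY] with q hq hq'; rw [hq, hq']
  have key : ∀ {g g' : M → ℝ}, g =ᶠ[𝓝 p] g' →
      mvfderiv (𝓡 d) g p = mvfderiv (𝓡 d) g' p := fun {g g'} h ↦ by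
    ext v
    simp only [mvfderiv, ContinuousLinearMap.comp_apply]
    rw [h.mfderiv_eq]
    rfl
  simp only [koszul, key e1, key e2, key e3, hX.mlieBracket_vectorField_eq hY,
    hX.mlieBracket_vectorField_eq (EventuallyEq.refl _ Z),
    hY.mlieBracket_vectorField_eq (EventuallyEq.refl _ Z), hX.self_of_nhds, hY.self_of_nhds]

variable [IsContMDiffRiemannianBundle (𝓡 d) ∞ (EuclideanSpace ℝ (Fin d))
      (fun p : M ↦ TangentSpace (𝓡 d) p)]

theorem FieldDiffAt.inner (hX : FieldDiffAt X p) (hY : FieldDiffAt Y p) :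
    MDifferentiableAt (𝓡 d) 𝓘(ℝ, ℝ) (fun q ↦ inner ℝ (X q) (Y q)) p :=
  haveI : IsContMDiffRiemannianBundle (𝓡 d) 1 (EuclideanSpace ℝ (Fin d))
      (fun p : M ↦ TangentSpace (𝓡 d) p) := IsContMDiffRiemannianBundle.of_le (n := ∞) (by simp)
  MDifferentiableAt.inner_bundle (IB := 𝓡 d) (E := fun p : M ↦ TangentSpace (𝓡 d) p) hX hY

/-- Tensoriality in `Z` means that only `Z p` matters, so the extensions chosen in the definition of
`leviCivita` are harmless. -/
theorem koszul_tensorialAt (hX : FieldDiffAt X p) (hY : FieldDiffAt Y p) :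
    TensorialAt (𝓡 d) (EuclideanSpace ℝ (Fin d)) (fun Z ↦ koszul X Y Z p) p where
  smul {f Z} hf hZ := by
    simp only [koszul, Pi.smul_apply', inner_smul_right]
    rw [mvfderiv_fun_mul hf (hY.inner hZ)]
    rw [mvfderiv_fun_mul hf (hX.inner hZ)]
    rw [mlieBracket_smul_right hf hZ, mlieBracket_smul_right hf hZ]
    simp [inner_add_left, inner_smul_left, real_inner_comm]
    ring
  add {Z Z'} hZ hZ' := by
    simp only [koszul, Pi.add_apply, inner_add_right]
    rw [mvfderiv_fun_add (hY.inner hZ) (hY.inner hZ')]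
    rw [mvfderiv_fun_add (hX.inner hZ) (hX.inner hZ')]
    rw [mlieBracket_add_right hZ hZ', mlieBracket_add_right hZ hZ']
    simp [inner_add_left]
    ring

theorem koszul_smul_left (hf : MDifferentiableAt (𝓡 d) 𝓘(ℝ, ℝ) f p) (hX : FieldDiffAt X p)
    (hY : FieldDiffAt Y p) (hZ : FieldDiffAt Z p) :
    koszul (f • X) Y Z p = f p * koszul X Y Z p := by
  simp only [koszul, Pi.smul_apply', inner_smul_left]
  simp only [conj_trivial]
  rw [mvfderiv_fun_mul hf (hX.inner hZ)]
  rw [mvfderiv_fun_mul hf (hX.inner hY)]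
  rw [mlieBracket_smul_left hf hX, mlieBracket_smul_left hf hX]
  simp [inner_add_left, inner_smul_left, real_inner_comm]
  ring

theorem koszul_add_left (hX : FieldDiffAt X p) (hX' : FieldDiffAt X' p)
    (hY : FieldDiffAt Y p) (hZ : FieldDiffAt Z p) :
    koszul (X + X') Y Z p = koszul X Y Z p + koszul X' Y Z p := by
  simp only [koszul, Pi.add_apply, inner_add_left]
  rw [mvfderiv_fun_add (hX.inner hZ) (hX'.inner hZ)]
  rw [mvfderiv_fun_add (hX.inner hY) (hX'.inner hY)]
  rw [mlieBracket_add_left hX hX', mlieBracket_add_left hX hX']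
  simp [inner_add_left, inner_add_right]
  ring

/-- The derivative of `f` along `X` appears twice, from X g(fY, Z) and from [X, fY], while the
derivatives along `Z` cancel. This is the source of the Leibniz rule for `leviCivita`. -/
theorem koszul_smul_middle (hf : MDifferentiableAt (𝓡 d) 𝓘(ℝ, ℝ) f p) (hX : FieldDiffAt X p)
    (hY : FieldDiffAt Y p) (hZ : FieldDiffAt Z p) :
    koszul X (f • Y) Z p = f p * koszul X Y Z p
      + 2 * mvfderiv (𝓡 d) f p (X p) * inner ℝ (Y p) (Z p) := by
  simp only [koszul, Pi.smul_apply', inner_smul_left, inner_smul_right]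
  simp only [conj_trivial]
  rw [mvfderiv_fun_mul hf (hY.inner hZ)]
  rw [mvfderiv_fun_mul hf (hX.inner hY)]
  rw [mlieBracket_smul_left hf hY, mlieBracket_smul_right hf hY]
  simp [inner_add_left, inner_smul_left, real_inner_comm]
  ring

theorem koszul_add_middle (hX : FieldDiffAt X p) (hY : FieldDiffAt Y p)
    (hY' : FieldDiffAt Y' p) (hZ : FieldDiffAt Z p) :
    koszul X (Y + Y') Z p = koszul X Y Z p + koszul X Y' Z p := by
  simp only [koszul, Pi.add_apply, inner_add_left, inner_add_right]
  rw [mvfderiv_fun_add (hY.inner hZ) (hY'.inner hZ)]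
  rw [mvfderiv_fun_add (hX.inner hY) (hX.inner hY')]
  rw [mlieBracket_add_left hY hY', mlieBracket_add_right hY hY']
  simp [inner_add_left]
  ring

theorem leviCivita_congr (hX : X =ᶠ[𝓝 p] X') (hY : Y =ᶠ[𝓝 p] Y') :
    leviCivita X Y p = leviCivita X' Y' p := by
  simp only [leviCivita, koszul_congr hX hY]

theorem fieldDiffAt_extendField (v : TangentSpace (𝓡 d) p) : FieldDiffAt (extendField v) p :=
  FiberBundle.mdifferentiableAt_extend (𝓡 d) (EuclideanSpace ℝ (Fin d)) v

@[simp] theorem extendField_self (v : TangentSpace (𝓡 d) p) : extendField v p = v :=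
  FiberBundle.extend_apply_self _ v

theorem smoothNear_extendField (v : TangentSpace (𝓡 d) p) : SmoothNear (extendField v) p := by
  obtain ⟨s, hs, h⟩ :=
    FiberBundle.exists_contMDiffOn_extend (k := ∞) (𝓡 d) (EuclideanSpace ℝ (Fin d)) v
  filter_upwards [eventually_mem_nhds_iff.2 hs] with q hq
  exact h.contMDiffAt hq

theorem SmoothNear.fieldDiffAt (h : SmoothNear X p) : FieldDiffAt X p :=
  h.self_of_nhds.mdifferentiableAt (by simp)

/-- The defining property of the Levi-Civita derivative. -/
theorem inner_leviCivita (hX : FieldDiffAt X p) (hY : FieldDiffAt Y p) (hZ : FieldDiffAt Z p) :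
    inner ℝ (leviCivita X Y p) (Z p) = 1 / 2 * koszul X Y Z p := by
  have hT := koszul_tensorialAt hX hY
  have key : ∀ W, FieldDiffAt W p → koszul X Y W p = TensorialAt.mkHom _ p hT (W p) :=
    fun W hW ↦ (hT.mkHom_apply hW).symm
  rw [key Z hZ]
  conv_rhs => rw [← (onb p).sum_repr' (Z p)]
  simp only [leviCivita, sum_inner, inner_smul_left, map_sum, map_smul, smul_eq_mul,
    Finset.mul_sum, conj_trivial]
  refine Finset.sum_congr rfl fun a _ ↦ ?_
  rw [key _ (fieldDiffAt_extendField _), extendField_self]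
  ring

/-- Nondegeneracy of the metric: this transfers each algebraic rule for `koszul` to `leviCivita`. -/
theorem leviCivita_eq_of_forall (hX : FieldDiffAt X p) (hY : FieldDiffAt Y p)
    {w : TangentSpace (𝓡 d) p}
    (h : ∀ Z, FieldDiffAt Z p → koszul X Y Z p = 2 * inner ℝ w (Z p)) :
    leviCivita X Y p = w := by
  refine ext_inner_right ℝ fun v ↦ ?_
  have := inner_leviCivita hX hY (fieldDiffAt_extendField v)
  rw [extendField_self] at this
  rw [this, h _ (fieldDiffAt_extendField v), extendField_self]
  ring

theorem koszul_eq (hX : FieldDiffAt X p) (hY : FieldDiffAt Y p) (hZ : FieldDiffAt Z p) :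
    koszul X Y Z p = 2 * inner ℝ (leviCivita X Y p) (Z p) := by
  rw [inner_leviCivita hX hY hZ]; ring

theorem FieldDiffAt.smul (hf : MDifferentiableAt (𝓡 d) 𝓘(ℝ, ℝ) f p) (hX : FieldDiffAt X p) :
    FieldDiffAt (f • X) p :=
  MDifferentiableAt.smul_section hf hX

theorem FieldDiffAt.add (hX : FieldDiffAt X p) (hX' : FieldDiffAt X' p) :
    FieldDiffAt (X + X') p :=
  mdifferentiableAt_add_section hX hX'

theorem leviCivita_smul_left (hf : MDifferentiableAt (𝓡 d) 𝓘(ℝ, ℝ) f p) (hX : FieldDiffAt X p)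
    (hY : FieldDiffAt Y p) : leviCivita (f • X) Y p = f p • leviCivita X Y p :=
  leviCivita_eq_of_forall (hX.smul hf) hY fun Z hZ ↦ by
    rw [koszul_smul_left hf hX hY hZ, koszul_eq hX hY hZ, inner_smul_left]
    simp only [conj_trivial]; ring

theorem leviCivita_add_left (hX : FieldDiffAt X p) (hX' : FieldDiffAt X' p)
    (hY : FieldDiffAt Y p) :
    leviCivita (X + X') Y p = leviCivita X Y p + leviCivita X' Y p :=
  leviCivita_eq_of_forall (hX.add hX') hY fun Z hZ ↦ by
    rw [koszul_add_left hX hX' hY hZ, koszul_eq hX hY hZ, koszul_eq hX' hY hZ, inner_add_left]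
    ring

theorem leviCivita_smul_right (hf : MDifferentiableAt (𝓡 d) 𝓘(ℝ, ℝ) f p) (hX : FieldDiffAt X p)
    (hY : FieldDiffAt Y p) :
    leviCivita X (f • Y) p = mvfderiv (𝓡 d) f p (X p) • Y p + f p • leviCivita X Y p :=
  leviCivita_eq_of_forall hX (hY.smul hf) fun Z hZ ↦ by
    rw [koszul_smul_middle hf hX hY hZ, koszul_eq hX hY hZ, inner_add_left, inner_smul_left,
      inner_smul_left]
    simp only [conj_trivial]; ring

theorem leviCivita_add_right (hX : FieldDiffAt X p) (hY : FieldDiffAt Y p)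
    (hY' : FieldDiffAt Y' p) :
    leviCivita X (Y + Y') p = leviCivita X Y p + leviCivita X Y' p :=
  leviCivita_eq_of_forall hX (hY.add hY') fun Z hZ ↦ by
    rw [koszul_add_middle hX hY hY' hZ, koszul_eq hX hY hZ, koszul_eq hX hY' hZ, inner_add_left]
    ring

/-- The Levi-Civita derivative is torsion free. -/
theorem leviCivita_sub_leviCivita (hX : FieldDiffAt X p) (hY : FieldDiffAt Y p) :
    leviCivita X Y p - leviCivita Y X p = mlieBracket (𝓡 d) X Y p := by
  refine ext_inner_right ℝ fun v ↦ ?_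
  have h1 := inner_leviCivita hX hY (fieldDiffAt_extendField v)
  have h2 := inner_leviCivita hY hX (fieldDiffAt_extendField v)
  rw [extendField_self] at h1 h2
  rw [inner_sub_left, h1, h2]
  have e : (fun q ↦ inner ℝ (X q) (Y q)) = fun q ↦ inner ℝ (Y q) (X q) := by
    ext q; exact real_inner_comm _ _
  simp only [koszul, extendField_self, e, mlieBracket_swap_apply (V := Y) (W := X),
    inner_neg_left]
  ring

end LeviCivita

/-! ### Smoothness in the presence of an orthonormal frame -/

section Curvature
open VectorField Filter Topology

set_option linter.unusedSectionVars false

variable {d : ℕ} {M : Type*} [TopologicalSpace M]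
  [ChartedSpace (EuclideanSpace ℝ (Fin d)) M] [IsManifold (𝓡 d) ∞ M]
  [RiemannianBundle (fun p : M ↦ TangentSpace (𝓡 d) p)]
  [IsContMDiffRiemannianBundle (𝓡 d) ∞ (EuclideanSpace ℝ (Fin d))
      (fun p : M ↦ TangentSpace (𝓡 d) p)]
  {X X' Y Y' Z Z' : (p : M) → TangentSpace (𝓡 d) p} {f g : M → ℝ} {p : M}

/-- The function `f` is smooth on a neighbourhood of `p`. -/
def FunSmoothNear (d : ℕ) {M : Type*} [TopologicalSpace M]
    [ChartedSpace (EuclideanSpace ℝ (Fin d)) M] (f : M → ℝ) (p : M) : Prop :=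
  ∀ᶠ q in 𝓝 p, ContMDiffAt (𝓡 d) 𝓘(ℝ, ℝ) ∞ f q

theorem FunSmoothNear.mdifferentiableAt (h : FunSmoothNear d f p) :
    MDifferentiableAt (𝓡 d) 𝓘(ℝ, ℝ) f p :=
  h.self_of_nhds.mdifferentiableAt (by simp)

theorem FunSmoothNear.eventually (h : FunSmoothNear d f p) : ∀ᶠ q in 𝓝 p, FunSmoothNear d f q :=
  h.eventually_nhds

theorem SmoothNear.eventually (h : SmoothNear X p) : ∀ᶠ q in 𝓝 p, SmoothNear X q :=
  h.eventually_nhds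

theorem FunSmoothNear.congr (h : FunSmoothNear d f p) (hg : g =ᶠ[𝓝 p] f) :
    FunSmoothNear d g p := by
  filter_upwards [h, hg.eventuallyEq_nhds] with q h1 h2
  exact h1.congr_of_eventuallyEq h2

theorem SmoothNear.congr (h : SmoothNear X p) (hX : X' =ᶠ[𝓝 p] X) : SmoothNear X' p := by
  filter_upwards [h, hX.eventuallyEq_nhds] with q h1 h2
  refine h1.congr_of_eventuallyEq ?_
  filter_upwards [h2] with r hr
  rw [hr]

theorem FunSmoothNear.add (hf : FunSmoothNear d f p) (hg : FunSmoothNear d g p) :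
    FunSmoothNear d (fun q ↦ f q + g q) p := by
  filter_upwards [hf, hg] with q h1 h2 using h1.add h2

theorem FunSmoothNear.sub (hf : FunSmoothNear d f p) (hg : FunSmoothNear d g p) :
    FunSmoothNear d (fun q ↦ f q - g q) p := by
  filter_upwards [hf, hg] with q h1 h2 using h1.sub h2

theorem FunSmoothNear.mul (hf : FunSmoothNear d f p) (hg : FunSmoothNear d g p) :
    FunSmoothNear d (fun q ↦ f q * g q) p := by
  filter_upwards [hf, hg] with q h1 h2 using h1.mul h2

theorem funSmoothNear_const (c : ℝ) : FunSmoothNear d (fun _ : M ↦ c) p :=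
  Eventually.of_forall fun _ ↦ contMDiffAt_const

theorem SmoothNear.add (hX : SmoothNear X p) (hY : SmoothNear Y p) : SmoothNear (X + Y) p := by
  filter_upwards [hX, hY] with q h1 h2 using h1.add_section h2

theorem SmoothNear.smul (hf : FunSmoothNear d f p) (hX : SmoothNear X p) :
    SmoothNear (f • X) p := by
  filter_upwards [hf, hX] with q h1 h2 using h1.smul_section h2

theorem SmoothNear.sum {ι : Type*} [Fintype ι] {X : ι → (p : M) → TangentSpace (𝓡 d) p}
    (hX : ∀ a, SmoothNear (X a) p) : SmoothNear (fun q ↦ ∑ a, X a q) p := by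
  filter_upwards [eventually_all.2 hX] with q h
  exact ContMDiffAt.sum_section fun a _ ↦ h a

theorem SmoothNear.inner (hX : SmoothNear X p) (hY : SmoothNear Y p) :
    FunSmoothNear d (fun q ↦ inner ℝ (X q) (Y q)) p := by
  filter_upwards [hX, hY] with q h1 h2
  exact ContMDiffAt.inner_bundle (IB := 𝓡 d) (E := fun p : M ↦ TangentSpace (𝓡 d) p) h1 h2

theorem SmoothNear.mlieBracket (hX : SmoothNear X p) (hY : SmoothNear Y p) :
    SmoothNear (VectorField.mlieBracket (𝓡 d) X Y) p := by
  have : IsManifold (𝓡 d) (((⊤ : ℕ∞) : WithTop ℕ∞) + 1) M :=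
    inferInstanceAs (IsManifold (𝓡 d) ∞ M)
  have : IsManifold (𝓡 d) (minSmoothness ℝ 2) M := by
    rw [minSmoothness_of_isRCLikeNormedField]; infer_instance
  filter_upwards [hX, hY] with q h1 h2
  exact ContMDiffAt.mlieBracket_vectorField (m := (⊤ : ℕ∞)) (n := (⊤ : ℕ∞)) h1 h2 (by simp)

/-- The fields `e a` are a smooth orthonormal frame of the tangent bundle on the open set `U`. -/
structure IsOrthonormalFrameOn {ι : Type*} [Fintype ι] (U : Set M)
    (e : ι → (p : M) → TangentSpace (𝓡 d) p) : Prop where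
  isOpen : IsOpen U
  smoothNear : ∀ p ∈ U, ∀ a, SmoothNear (e a) p
  orthonormal : ∀ p ∈ U, Orthonormal ℝ (fun a ↦ e a p)
  span_eq_top : ∀ p ∈ U, Submodule.span ℝ (Set.range fun a ↦ e a p) = ⊤

namespace IsOrthonormalFrameOn
variable {ι : Type*} [Fintype ι] {U : Set M} {e : ι → (p : M) → TangentSpace (𝓡 d) p}

/-- The frame at a point as an orthonormal basis. -/
def basisAt (he : IsOrthonormalFrameOn U e) (hp : p ∈ U) :
    OrthonormalBasis ι ℝ (TangentSpace (𝓡 d) p) :=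
  OrthonormalBasis.mk (he.orthonormal p hp) (he.span_eq_top p hp).ge

@[simp] theorem basisAt_apply (he : IsOrthonormalFrameOn U e) (hp : p ∈ U) (a : ι) :
    he.basisAt hp a = e a p := by
  simp [basisAt]

theorem sum_inner_smul (he : IsOrthonormalFrameOn U e) (hp : p ∈ U) (v : TangentSpace (𝓡 d) p) :
    ∑ a, inner ℝ (e a p) v • e a p = v := by
  simpa using (he.basisAt hp).sum_repr' v

theorem eventually_eq_sum (he : IsOrthonormalFrameOn U e) (hp : p ∈ U)
    (X : (p : M) → TangentSpace (𝓡 d) p) :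
    X =ᶠ[𝓝 p] fun q ↦ ∑ a, ((fun q ↦ inner ℝ (e a q) (X q)) • e a) q := by
  filter_upwards [he.isOpen.mem_nhds hp] with q hq
  exact (he.sum_inner_smul hq (X q)).symm

theorem smoothNear_of_inner (he : IsOrthonormalFrameOn U e) (hp : p ∈ U)
    (h : ∀ a, FunSmoothNear d (fun q ↦ inner ℝ (e a q) (X q)) p) : SmoothNear X p :=
  (SmoothNear.sum fun a ↦ (he.smoothNear p hp a).smul (h a)).congr (he.eventually_eq_sum hp X)

/-- The derivative of a smooth function along a smooth field is smooth. -/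
theorem funSmoothNear_mvfderiv [Nonempty ι] (he : IsOrthonormalFrameOn U e) (hp : p ∈ U)
    (hf : FunSmoothNear d f p) (hX : SmoothNear X p) :
    FunSmoothNear d (fun q ↦ mvfderiv (𝓡 d) f q (X q)) p := by
  obtain ⟨a⟩ := ‹Nonempty ι›
  have ha := he.smoothNear p hp a
  -- Pairing [X, f e_a] = X(f) e_a + f [X, e_a] with the unit field e_a isolates X(f), so its
  -- smoothness follows from that of brackets and of the metric.
  have h1 := (hX.mlieBracket (ha.smul hf)).inner ha
  have h2 := hf.mul ((hX.mlieBracket ha).inner ha)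
  refine (h1.sub h2).congr ?_
  filter_upwards [he.isOpen.mem_nhds hp, hf.eventually, ha.eventually] with q hq h3 h4
  rw [mlieBracket_smul_right h3.mdifferentiableAt h4.fieldDiffAt, inner_add_left, inner_smul_left,
    inner_smul_left, real_inner_self_eq_norm_sq, (he.orthonormal q hq).1 a]
  simp

theorem funSmoothNear_koszul [Nonempty ι] (he : IsOrthonormalFrameOn U e) (hp : p ∈ U)
    (hX : SmoothNear X p) (hY : SmoothNear Y p) (hZ : SmoothNear Z p) :
    FunSmoothNear d (koszul X Y Z) p :=
  ((((((he.funSmoothNear_mvfderiv hp (hY.inner hZ) hX).add (he.funSmoothNear_mvfderiv hp (hX.inner hZ) hY)).sub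
    (he.funSmoothNear_mvfderiv hp (hX.inner hY) hZ))).add ((hX.mlieBracket hY).inner hZ)).sub
      ((hX.mlieBracket hZ).inner hY)).sub ((hY.mlieBracket hZ).inner hX)

/-- The bases `onb` in the definition need not vary smoothly with the point, so smoothness is read
off from the components in the smooth frame, which are half the Koszul expressions. -/
theorem smoothNear_leviCivita [Nonempty ι] (he : IsOrthonormalFrameOn U e) (hp : p ∈ U)
    (hX : SmoothNear X p) (hY : SmoothNear Y p) : SmoothNear (leviCivita X Y) p := by
  refine he.smoothNear_of_inner hp fun a ↦ ?_
  refine ((funSmoothNear_const (1 / 2)).mul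
    (he.funSmoothNear_koszul hp hX hY (he.smoothNear p hp a))).congr ?_
  filter_upwards [hX.eventually, hY.eventually, (he.smoothNear p hp a).eventually] with q h1 h2 h3
  rw [real_inner_comm, inner_leviCivita h1.fieldDiffAt h2.fieldDiffAt h3.fieldDiffAt]

/-- The bracket of vector fields acts on functions as the commutator. -/
theorem mvfderiv_mlieBracket [Nonempty ι] (he : IsOrthonormalFrameOn U e) (hp : p ∈ U)
    (hX : SmoothNear X p) (hY : SmoothNear Y p) (hf : FunSmoothNear d f p) :
    mvfderiv (𝓡 d) f p (mlieBracket (𝓡 d) X Y p) =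
      mvfderiv (𝓡 d) (fun q ↦ mvfderiv (𝓡 d) f q (Y q)) p (X p)
        - mvfderiv (𝓡 d) (fun q ↦ mvfderiv (𝓡 d) f q (X q)) p (Y p) := by
  obtain ⟨a⟩ := ‹Nonempty ι›
  have : IsManifold (𝓡 d) (minSmoothness ℝ 3) M := by
    rw [minSmoothness_of_isRCLikeNormedField]; infer_instance
  have ha := he.smoothNear p hp a
  have sm : ∀ {W : (p : M) → TangentSpace (𝓡 d) p}, SmoothNear W p →
      ContMDiffAt (𝓡 d) ((𝓡 d).prod 𝓘(ℝ, EuclideanSpace ℝ (Fin d))) (minSmoothness ℝ 2)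
    (fun q ↦ (⟨q, W q⟩ : TotalSpace (EuclideanSpace ℝ (Fin d)) (TangentSpace (𝓡 d) (M := M)))) p :=
    fun h ↦ h.self_of_nhds.of_le (by
      rw [minSmoothness_of_isRCLikeNormedField]; exact ENat.LEInfty.out)
  have J := leibniz_identity_mlieBracket_apply (sm hX) (sm hY) (sm ha)
  -- The Jacobi identity is compared for e_a and for f e_a. All terms of first order in `f` along
  -- `X` or `Y` alone cancel, and the coefficient of e_a is the commutator formula.
  have J' := leibniz_identity_mlieBracket_apply (sm hX) (sm hY) (sm (ha.smul hf))
  have expand : ∀ {V : (p : M) → TangentSpace (𝓡 d) p}, 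
      mlieBracket (𝓡 d) V (f • e a) =ᶠ[𝓝 p]
      (fun q ↦ mvfderiv (𝓡 d) f q (V q)) • e a + f • mlieBracket (𝓡 d) V (e a) := by
    intro V
    filter_upwards [hf.eventually, ha.eventually] with q h3 h4
    exact mlieBracket_smul_right h3.mdifferentiableAt h4.fieldDiffAt
  have second : ∀ {V W : (p : M) → TangentSpace (𝓡 d) p}, SmoothNear V p → SmoothNear W p →
      mlieBracket (𝓡 d) V (mlieBracket (𝓡 d) W (f • e a)) p =
        mvfderiv (𝓡 d) (fun q ↦ mvfderiv (𝓡 d) f q (W q)) p (V p) • e a p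
        + mvfderiv (𝓡 d) f p (W p) • mlieBracket (𝓡 d) V (e a) p
        + (mvfderiv (𝓡 d) f p (V p) • mlieBracket (𝓡 d) W (e a) p
        + f p • mlieBracket (𝓡 d) V (mlieBracket (𝓡 d) W (e a)) p) := by
    intro V W hV hW
    have hWf := he.funSmoothNear_mvfderiv hp hf hW
    have hWa := hW.mlieBracket ha
    rw [(EventuallyEq.refl _ V).mlieBracket_vectorField_eq expand,
      mlieBracket_add_right (ha.smul hWf).fieldDiffAt (hWa.smul hf).fieldDiffAt,
      mlieBracket_smul_right hWf.mdifferentiableAt ha.fieldDiffAt,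
      mlieBracket_smul_right hf.mdifferentiableAt hWa.fieldDiffAt]
  rw [second hX hY, second hY hX, J,
    mlieBracket_smul_right hf.mdifferentiableAt ha.fieldDiffAt] at J'
  have J2 := congrArg (fun v ↦ inner ℝ (e a p) v) J'
  simp only [inner_add_right, inner_smul_right, real_inner_self_eq_norm_sq,
    (he.orthonormal p hp).1 a] at J2
  linarith

end IsOrthonormalFrameOn
end Curvature

/-! ### Tensoriality of curvature; Ricci tensor and Hessian in a frame -/

section FrameFormulas
open VectorField Filter Topology

set_option linter.unusedSectionVars false

variable {d : ℕ} {M : Type*} [TopologicalSpace M]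
  [ChartedSpace (EuclideanSpace ℝ (Fin d)) M] [IsManifold (𝓡 d) ∞ M]
  [RiemannianBundle (fun p : M ↦ TangentSpace (𝓡 d) p)]
  [IsContMDiffRiemannianBundle (𝓡 d) ∞ (EuclideanSpace ℝ (Fin d))
      (fun p : M ↦ TangentSpace (𝓡 d) p)]
  {X X' Y Y' Z Z' : (p : M) → TangentSpace (𝓡 d) p} {f g : M → ℝ} {p : M}

theorem mvfderiv_congr (h : f =ᶠ[𝓝 p] g) : mvfderiv (𝓡 d) f p = mvfderiv (𝓡 d) g p := by
  ext v
  simp only [mvfderiv, ContinuousLinearMap.comp_apply]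
  rw [h.mfderiv_eq]
  rfl

theorem leviCivita_neg_left (hX : FieldDiffAt X p) (hY : FieldDiffAt Y p) :
    leviCivita (-X) Y p = -leviCivita X Y p := by
  have h := leviCivita_smul_left (f := fun _ : M ↦ (-1 : ℝ)) mdifferentiableAt_const hX hY
  have e : (fun _ : M ↦ (-1 : ℝ)) • X = -X := by
    ext q; simp
  rw [e] at h
  simpa using h

/-- Reduces linearity in the second argument to linearity in the first. -/
theorem curvature_swap (hX : SmoothNear X p) (hY : SmoothNear Y p) (hZ : SmoothNear Z p) :
    curvature X Y Z p = -curvature Y X Z p := by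
  simp only [curvature]
  rw [mlieBracket_swap, leviCivita_neg_left (hY.mlieBracket hX).fieldDiffAt hZ.fieldDiffAt]
  abel

theorem curvature_congr (hX : X =ᶠ[𝓝 p] X') (hY : Y =ᶠ[𝓝 p] Y') (hZ : Z =ᶠ[𝓝 p] Z') :
    curvature X Y Z p = curvature X' Y' Z' p := by
  have key : ∀ {V V' W W' : (p : M) → TangentSpace (𝓡 d) p}, V =ᶠ[𝓝 p] V' → W =ᶠ[𝓝 p] W' →
      leviCivita V W =ᶠ[𝓝 p] leviCivita V' W' := fun h1 h2 ↦ by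
    filter_upwards [h1.eventuallyEq_nhds, h2.eventuallyEq_nhds] with q h3 h4
    exact leviCivita_congr h3 h4
  simp only [curvature]
  rw [leviCivita_congr hX (key hY hZ), leviCivita_congr hY (key hX hZ),
    leviCivita_congr (hX.mlieBracket_vectorField hY) hZ]

namespace IsOrthonormalFrameOn
variable {ι : Type*} [Fintype ι] [Nonempty ι] {U : Set M} {e : ι → (p : M) → TangentSpace (𝓡 d) p}

theorem curvature_add_left (he : IsOrthonormalFrameOn U e) (hp : p ∈ U)
    (hX : SmoothNear X p) (hX' : SmoothNear X' p) (hY : SmoothNear Y p) (hZ : SmoothNear Z p) :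
    curvature (X + X') Y Z p = curvature X Y Z p + curvature X' Y Z p := by
  have e1 : leviCivita (X + X') Z =ᶠ[𝓝 p] leviCivita X Z + leviCivita X' Z := by
    filter_upwards [hX.eventually, hX'.eventually, hZ.eventually] with q h1 h2 h3
    exact leviCivita_add_left h1.fieldDiffAt h2.fieldDiffAt h3.fieldDiffAt
  have e2 : mlieBracket (𝓡 d) (X + X') Y =ᶠ[𝓝 p]
      mlieBracket (𝓡 d) X Y + mlieBracket (𝓡 d) X' Y := by
    filter_upwards [hX.eventually, hX'.eventually] with q h1 h2
    exact mlieBracket_add_left h1.fieldDiffAt h2.fieldDiffAt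
  simp only [curvature]
  rw [leviCivita_congr (EventuallyEq.refl _ Y) e1, leviCivita_congr e2 (EventuallyEq.refl _ Z),
    leviCivita_add_left hX.fieldDiffAt hX'.fieldDiffAt (he.smoothNear_leviCivita hp hY hZ).fieldDiffAt,
    leviCivita_add_right hY.fieldDiffAt (he.smoothNear_leviCivita hp hX hZ).fieldDiffAt
      (he.smoothNear_leviCivita hp hX' hZ).fieldDiffAt,
    leviCivita_add_left (hX.mlieBracket hY).fieldDiffAt (hX'.mlieBracket hY).fieldDiffAt
      hZ.fieldDiffAt]
  abel

/-- The term Y(f) ∇_X Z produced by ∇_Y(f ∇_X Z) cancels against the one produced by [fX, Y] = f [X,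
Y] - Y(f) X. -/
theorem curvature_smul_left (he : IsOrthonormalFrameOn U e) (hp : p ∈ U)
    (hf : FunSmoothNear d f p) (hX : SmoothNear X p) (hY : SmoothNear Y p)
    (hZ : SmoothNear Z p) : curvature (f • X) Y Z p = f p • curvature X Y Z p := by
  have e1 : leviCivita (f • X) Z =ᶠ[𝓝 p] f • leviCivita X Z := by
    filter_upwards [hf.eventually, hX.eventually, hZ.eventually] with q h1 h2 h3
    exact leviCivita_smul_left h1.mdifferentiableAt h2.fieldDiffAt h3.fieldDiffAt
  have e2 : mlieBracket (𝓡 d) (f • X) Y =ᶠ[𝓝 p]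
      (fun q ↦ (-1) * mvfderiv (𝓡 d) f q (Y q)) • X + f • mlieBracket (𝓡 d) X Y := by
    filter_upwards [hf.eventually, hX.eventually] with q h1 h2
    rw [mlieBracket_smul_left h1.mdifferentiableAt h2.fieldDiffAt]
    simp only [Pi.add_apply, Pi.smul_apply', neg_one_mul]
    rfl
  have hYf := (funSmoothNear_const (-1)).mul (he.funSmoothNear_mvfderiv hp hf hY)
  have hXY := hX.mlieBracket hY
  simp only [curvature]
  rw [leviCivita_congr (EventuallyEq.refl _ Y) e1, leviCivita_congr e2 (EventuallyEq.refl _ Z),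
    leviCivita_smul_left hf.mdifferentiableAt hX.fieldDiffAt (he.smoothNear_leviCivita hp hY hZ).fieldDiffAt,
    leviCivita_smul_right hf.mdifferentiableAt hY.fieldDiffAt
      (he.smoothNear_leviCivita hp hX hZ).fieldDiffAt,
    leviCivita_add_left (hX.smul hYf).fieldDiffAt (hXY.smul hf).fieldDiffAt
      hZ.fieldDiffAt,
    leviCivita_smul_left hYf.mdifferentiableAt hX.fieldDiffAt hZ.fieldDiffAt,
    leviCivita_smul_left hf.mdifferentiableAt hXY.fieldDiffAt hZ.fieldDiffAt]
  module

theorem curvature_add_right (he : IsOrthonormalFrameOn U e) (hp : p ∈ U)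
    (hX : SmoothNear X p) (hY : SmoothNear Y p) (hZ : SmoothNear Z p) (hZ' : SmoothNear Z' p) :
    curvature X Y (Z + Z') p = curvature X Y Z p + curvature X Y Z' p := by
  have e1 : ∀ {V : (p : M) → TangentSpace (𝓡 d) p}, SmoothNear V p →
      leviCivita V (Z + Z') =ᶠ[𝓝 p] leviCivita V Z + leviCivita V Z' := fun hV ↦ by
    filter_upwards [hV.eventually, hZ.eventually, hZ'.eventually] with q h1 h2 h3
    exact leviCivita_add_right h1.fieldDiffAt h2.fieldDiffAt h3.fieldDiffAt
  simp only [curvature]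
  rw [leviCivita_congr (EventuallyEq.refl _ X) (e1 hY),
    leviCivita_congr (EventuallyEq.refl _ Y) (e1 hX),
    leviCivita_add_right hX.fieldDiffAt (he.smoothNear_leviCivita hp hY hZ).fieldDiffAt
      (he.smoothNear_leviCivita hp hY hZ').fieldDiffAt,
    leviCivita_add_right hY.fieldDiffAt (he.smoothNear_leviCivita hp hX hZ).fieldDiffAt
      (he.smoothNear_leviCivita hp hX hZ').fieldDiffAt,
    leviCivita_add_right (hX.mlieBracket hY).fieldDiffAt hZ.fieldDiffAt hZ'.fieldDiffAt]
  abel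

/-- The first-order terms cancel in pairs, and the second derivatives of `f` cancel because [X, Y]
acts on functions as the commutator. -/
theorem curvature_smul_right (he : IsOrthonormalFrameOn U e) (hp : p ∈ U)
    (hf : FunSmoothNear d f p) (hX : SmoothNear X p) (hY : SmoothNear Y p)
    (hZ : SmoothNear Z p) : curvature X Y (f • Z) p = f p • curvature X Y Z p := by
  have e1 : ∀ {V : (p : M) → TangentSpace (𝓡 d) p}, SmoothNear V p →
      leviCivita V (f • Z) =ᶠ[𝓝 p]
        (fun q ↦ mvfderiv (𝓡 d) f q (V q)) • Z + f • leviCivita V Z := fun hV ↦ by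
    filter_upwards [hf.eventually, hV.eventually, hZ.eventually] with q h1 h2 h3
    exact leviCivita_smul_right h1.mdifferentiableAt h2.fieldDiffAt h3.fieldDiffAt
  have e2 : ∀ {V W : (p : M) → TangentSpace (𝓡 d) p}, SmoothNear V p → SmoothNear W p →
      leviCivita V (leviCivita W (f • Z)) p =
        (mvfderiv (𝓡 d) (fun q ↦ mvfderiv (𝓡 d) f q (W q)) p (V p) • Z p
          + mvfderiv (𝓡 d) f p (W p) • leviCivita V Z p)
        + (mvfderiv (𝓡 d) f p (V p) • leviCivita W Z p
          + f p • leviCivita V (leviCivita W Z) p) := fun {V W} hV hW ↦ by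
    have hWf := he.funSmoothNear_mvfderiv hp hf hW
    have hWZ := he.smoothNear_leviCivita hp hW hZ
    rw [leviCivita_congr (EventuallyEq.refl _ V) (e1 hW),
      leviCivita_add_right hV.fieldDiffAt (hZ.smul hWf).fieldDiffAt (hWZ.smul hf).fieldDiffAt,
      leviCivita_smul_right hWf.mdifferentiableAt hV.fieldDiffAt hZ.fieldDiffAt,
      leviCivita_smul_right hf.mdifferentiableAt hV.fieldDiffAt hWZ.fieldDiffAt]
  simp only [curvature]
  rw [e2 hX hY, e2 hY hX, leviCivita_smul_right hf.mdifferentiableAt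
    (hX.mlieBracket hY).fieldDiffAt hZ.fieldDiffAt, he.mvfderiv_mlieBracket hp hX hY hf]
  module

/-- An operation on smooth vector fields which is local and linear over the smooth functions is
determined by its values on a frame. -/
theorem tensorial_eq_sum {A : Type*} [AddCommGroup A] [Module ℝ A]
    (he : IsOrthonormalFrameOn U e) (hp : p ∈ U) (Φ : ((p : M) → TangentSpace (𝓡 d) p) → A)
    (congr : ∀ X X', X =ᶠ[𝓝 p] X' → Φ X = Φ X')
    (add : ∀ X X', SmoothNear X p → SmoothNear X' p → Φ (X + X') = Φ X + Φ X')
    (smul : ∀ f X, FunSmoothNear d f p → SmoothNear X p → Φ (f • X) = f p • Φ X)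
    (hX : SmoothNear X p) : Φ X = ∑ a, inner ℝ (e a p) (X p) • Φ (e a) := by
  classical
  rw [congr _ _ (he.eventually_eq_sum hp X)]
  have hc : ∀ a, FunSmoothNear d (fun q ↦ inner ℝ (e a q) (X q)) p :=
    fun a ↦ (he.smoothNear p hp a).inner hX
  -- Smoothness of the partial sums is carried through the induction because `add` is only available
  -- for smooth fields.
  suffices h : ∀ s : Finset ι,
      SmoothNear (fun q ↦ ∑ a ∈ s, ((fun q ↦ inner ℝ (e a q) (X q)) • e a) q) p ∧
      Φ (fun q ↦ ∑ a ∈ s, ((fun q ↦ inner ℝ (e a q) (X q)) • e a) q) =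
        ∑ a ∈ s, inner ℝ (e a p) (X p) • Φ (e a) from (h Finset.univ).2
  intro s
  induction s using Finset.induction_on with
  | empty =>
    have e0 : (fun q ↦ ∑ a ∈ (∅ : Finset ι), ((fun q ↦ inner ℝ (e a q) (X q)) • e a) q) =
        (fun _ : M ↦ (0 : ℝ)) • X := by
      ext q; simp
    rw [e0]
    exact ⟨hX.smul (funSmoothNear_const 0), by rw [smul _ _ (funSmoothNear_const 0) hX]; simp⟩
  | insert a s ha ih =>
    have e1 : (fun q ↦ ∑ a ∈ insert a s, ((fun q ↦ inner ℝ (e a q) (X q)) • e a) q) =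
        (fun q ↦ inner ℝ (e a q) (X q)) • e a +
          fun q ↦ ∑ a ∈ s, ((fun q ↦ inner ℝ (e a q) (X q)) • e a) q := by
      ext q; simp [Finset.sum_insert ha]
    have h1 := (he.smoothNear p hp a).smul (hc a)
    rw [e1]
    exact ⟨h1.add ih.1, by
      rw [add _ _ h1 ih.1, smul _ _ (hc a) (he.smoothNear p hp a), ih.2, Finset.sum_insert ha]⟩

theorem leviCivita_eq_sum (he : IsOrthonormalFrameOn U e) (hp : p ∈ U)
    (hX : SmoothNear X p) (hY : SmoothNear Y p) :
    leviCivita X Y p = ∑ a, inner ℝ (e a p) (X p) • leviCivita (e a) Y p :=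
  he.tensorial_eq_sum hp (fun X ↦ leviCivita X Y p)
    (fun _ _ h ↦ leviCivita_congr h (EventuallyEq.refl _ Y))
    (fun _ _ h h' ↦ leviCivita_add_left h.fieldDiffAt h'.fieldDiffAt hY.fieldDiffAt)
    (fun _ _ hf h ↦ leviCivita_smul_left hf.mdifferentiableAt h.fieldDiffAt hY.fieldDiffAt) hX

theorem curvature_eq_sum (he : IsOrthonormalFrameOn U e) (hp : p ∈ U)
    (hX : SmoothNear X p) (hY : SmoothNear Y p) (hZ : SmoothNear Z p) :
    curvature X Y Z p = ∑ b, ∑ c, (inner ℝ (e b p) (Y p) * inner ℝ (e c p) (Z p)) •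
      ∑ a, inner ℝ (e a p) (X p) • curvature (e a) (e b) (e c) p := by
  have h1 : ∀ {Y Z}, SmoothNear Y p → SmoothNear Z p →
      curvature X Y Z p = ∑ a, inner ℝ (e a p) (X p) • curvature (e a) Y Z p :=
    fun {Y Z} hY hZ ↦ he.tensorial_eq_sum hp (fun X ↦ curvature X Y Z p)
      (fun _ _ h ↦ curvature_congr h (EventuallyEq.refl _ Y) (EventuallyEq.refl _ Z))
      (fun _ _ h h' ↦ he.curvature_add_left hp h h' hY hZ)
      (fun _ _ hf h ↦ he.curvature_smul_left hp hf h hY hZ) hX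
  have h2 : ∀ {Z}, SmoothNear Z p →
      curvature X Y Z p = ∑ b, inner ℝ (e b p) (Y p) • curvature X (e b) Z p :=
    fun {Z} hZ ↦ he.tensorial_eq_sum hp (fun Y ↦ curvature X Y Z p)
      (fun _ _ h ↦ curvature_congr (EventuallyEq.refl _ X) h (EventuallyEq.refl _ Z))
      (fun Y Y' h h' ↦ by
        rw [curvature_swap hX (h.add h') hZ, he.curvature_add_left hp h h' hX hZ,
          curvature_swap hX h hZ, curvature_swap hX h' hZ]
        abel)
      (fun f Y hf h ↦ by
        rw [curvature_swap hX (h.smul hf) hZ, he.curvature_smul_left hp hf h hX hZ,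
          curvature_swap hX h hZ, smul_neg]) hY
  have h3 : ∀ b, curvature X (e b) Z p =
      ∑ c, inner ℝ (e c p) (Z p) • curvature X (e b) (e c) p :=
    fun b ↦ he.tensorial_eq_sum hp (fun Z ↦ curvature X (e b) Z p)
      (fun _ _ h ↦ curvature_congr (EventuallyEq.refl _ X) (EventuallyEq.refl _ (e b)) h)
      (fun _ _ h h' ↦ he.curvature_add_right hp hX (he.smoothNear p hp b) h h')
      (fun _ _ hf h ↦ he.curvature_smul_right hp hf hX (he.smoothNear p hp b) h) hZ
  rw [h2 hZ]
  refine Finset.sum_congr rfl fun b _ ↦ ?_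
  rw [h3 b, Finset.smul_sum]
  refine Finset.sum_congr rfl fun c _ ↦ ?_
  rw [h1 (he.smoothNear p hp b) (he.smoothNear p hp c), mul_smul]

/-- The Ricci tensor is a trace over any orthonormal frame. -/
theorem ricci_eq_sum (he : IsOrthonormalFrameOn U e) (hp : p ∈ U) (u v : TangentSpace (𝓡 d) p) :
    ricci p u v = ∑ b, ∑ c, (inner ℝ (e b p) u * inner ℝ (e c p) v) *
      ∑ a, inner ℝ (curvature (e a) (e b) (e c) p) (e a p) := by
  -- Ricci is a combination of traces of the maps `T b c`. The trace does not depend on the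
  -- orthonormal basis, so `onb p` can be exchanged for the frame.
  let T : ι → ι → TangentSpace (𝓡 d) p →ₗ[ℝ] TangentSpace (𝓡 d) p := fun b c ↦
    ∑ a, (innerₗ _ (e a p)).smulRight (curvature (e a) (e b) (e c) p)
  have hT : ∀ b c w, T b c w = ∑ a, inner ℝ (e a p) w • curvature (e a) (e b) (e c) p := by
    intro b c w
    simp [T, LinearMap.sum_apply]
  have h1 : ricci p u v = ∑ i, inner ℝ (onb p i)
      (∑ b, ∑ c, (inner ℝ (e b p) u * inner ℝ (e c p) v) • T b c (onb p i)) := by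
    simp only [ricci]
    refine Finset.sum_congr rfl fun i _ ↦ ?_
    rw [he.curvature_eq_sum hp (smoothNear_extendField _) (smoothNear_extendField _)
      (smoothNear_extendField _), real_inner_comm]
    simp only [extendField_self, hT]
  simp only [inner_sum, inner_smul_right] at h1
  rw [h1, Finset.sum_comm]
  refine Finset.sum_congr rfl fun b _ ↦ ?_
  rw [Finset.sum_comm]
  refine Finset.sum_congr rfl fun c _ ↦ ?_
  rw [← Finset.mul_sum, ← LinearMap.trace_eq_sum_inner (T b c) (onb p),
    LinearMap.trace_eq_sum_inner (T b c) (he.basisAt hp)]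
  congr 1
  refine Finset.sum_congr rfl fun a _ ↦ ?_
  rw [hT, basisAt_apply, real_inner_comm]
  congr 1
  classical
  have ho := orthonormal_iff_ite.1 (he.orthonormal p hp)
  simp only [ho, ite_smul, one_smul, zero_smul]
  simp

/-- The connection coefficients of a frame. -/
def conn (e : ι → (p : M) → TangentSpace (𝓡 d) p) (a b c : ι) (q : M) : ℝ :=
  inner ℝ (e c q) (leviCivita (e a) (e b) q)

/-- The component of ∇_{e_a} X minus the derivative of the component of `X` is tensorial in `X`,
since the Leibniz terms cancel. On frame fields the second part vanishes and `conn` remains. -/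
theorem inner_leviCivita_sum (he : IsOrthonormalFrameOn U e) (hp : p ∈ U) (a d' : ι)
    (hX : SmoothNear X p) :
    inner ℝ (e d' p) (leviCivita (e a) X p) =
      mvfderiv (𝓡 d) (fun q ↦ inner ℝ (e d' q) (X q)) p (e a p) +
        ∑ c, inner ℝ (e c p) (X p) * conn e a c d' p := by
  classical
  have hs := he.smoothNear p hp
  have ho := orthonormal_iff_ite.1 (he.orthonormal p hp)
  have h := he.tensorial_eq_sum hp
    (fun X ↦ inner ℝ (e d' p) (leviCivita (e a) X p) -
      mvfderiv (𝓡 d) (fun q ↦ inner ℝ (e d' q) (X q)) p (e a p))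
    (fun (X X' : (p : M) → TangentSpace (𝓡 d) p) h ↦ by
      have e1 : (fun q ↦ inner ℝ (e d' q) (X q)) =ᶠ[𝓝 p] fun q ↦ inner ℝ (e d' q) (X' q) := by
        filter_upwards [h] with q hq; rw [hq]
      rw [leviCivita_congr (X := e a) (X' := e a) (Y := X) (Y' := X') (EventuallyEq.refl _ _) h,
        mvfderiv_congr e1])
    (fun X X' h h' ↦ by
      simp only [Pi.add_apply, inner_add_right]
      rw [leviCivita_add_right (hs a).fieldDiffAt h.fieldDiffAt h'.fieldDiffAt,
        mvfderiv_fun_add ((hs d').inner h).mdifferentiableAt ((hs d').inner h').mdifferentiableAt,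
        inner_add_right, add_apply]
      ring)
    (fun f X hf h ↦ by
      simp only [Pi.smul_apply', inner_smul_right]
      rw [leviCivita_smul_right hf.mdifferentiableAt (hs a).fieldDiffAt h.fieldDiffAt,
        mvfderiv_fun_mul hf.mdifferentiableAt ((hs d').inner h).mdifferentiableAt]
      simp only [inner_add_right, inner_smul_right, add_apply,
        smul_apply, smul_eq_mul]
      ring) hX
  have h0 : ∀ c, mvfderiv (𝓡 d) (fun q ↦ inner ℝ (e d' q) (e c q)) p (e a p) = 0 := by
    intro c
    have : (fun q ↦ inner ℝ (e d' q) (e c q)) =ᶠ[𝓝 p] fun _ ↦ if d' = c then (1 : ℝ) else 0 := by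
      filter_upwards [he.isOpen.mem_nhds hp] with q hq
      exact orthonormal_iff_ite.1 (he.orthonormal q hq) d' c
    rw [mvfderiv_congr this, mvfderiv_const]
    rfl
  simp only [h0, sub_zero, smul_eq_mul] at h
  rw [sub_eq_iff_eq_add'] at h
  exact h

theorem mlieBracket_inner (he : IsOrthonormalFrameOn U e) (hp : p ∈ U) (a b c : ι) :
    inner ℝ (e c p) (mlieBracket (𝓡 d) (e a) (e b) p) = conn e a b c p - conn e b a c p := by
  rw [← leviCivita_sub_leviCivita (he.smoothNear p hp a).fieldDiffAt
    (he.smoothNear p hp b).fieldDiffAt, inner_sub_right]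
  rfl

/-- Torsion-freeness expresses the components of [e_a, e_b] by `conn`, so only connection
coefficients and their derivatives occur. -/
theorem inner_curvature (he : IsOrthonormalFrameOn U e) (hp : p ∈ U) (a b c d' : ι) :
    inner ℝ (curvature (e a) (e b) (e c) p) (e d' p) =
      mvfderiv (𝓡 d) (conn e b c d') p (e a p)
        - mvfderiv (𝓡 d) (conn e a c d') p (e b p)
        + ∑ f, (conn e b c f p * conn e a f d' p - conn e a c f p * conn e b f d' p
          - (conn e a b f p - conn e b a f p) * conn e f c d' p) := by
  have hs := he.smoothNear p hp
  rw [real_inner_comm]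
  simp only [curvature, inner_sub_right]
  rw [he.inner_leviCivita_sum hp a d' (he.smoothNear_leviCivita hp (hs b) (hs c)),
    he.inner_leviCivita_sum hp b d' (he.smoothNear_leviCivita hp (hs a) (hs c)),
    he.leviCivita_eq_sum hp ((hs a).mlieBracket (hs b)) (hs c)]
  simp only [inner_sum, inner_smul_right, he.mlieBracket_inner hp, Finset.sum_sub_distrib]
  simp only [← conn.eq_def]
  ring

/-- The components of the Ricci tensor in terms of the connection coefficients. -/
theorem sum_inner_curvature (he : IsOrthonormalFrameOn U e) (hp : p ∈ U) (b c : ι) :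
    ∑ a, inner ℝ (curvature (e a) (e b) (e c) p) (e a p) =
      ∑ a, (mvfderiv (𝓡 d) (conn e b c a) p (e a p)
        - mvfderiv (𝓡 d) (conn e a c a) p (e b p))
      + ∑ f, conn e b c f p * ∑ a, conn e a f a p
      - ∑ a, ∑ f, conn e a b f p * conn e f c a p := by
  simp only [he.inner_curvature hp, Finset.sum_add_distrib, Finset.sum_sub_distrib, sub_mul,
    Finset.mul_sum]
  have h1 : ∑ a, ∑ f, conn e b c f p * conn e a f a p =
    ∑ f, ∑ a, conn e b c f p * conn e a f a p := Finset.sum_comm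
  -- Exchanging the summation labels `a` and `f` makes this term cancel against one half of the
  -- torsion term.
  have h2 : ∑ a, ∑ f, conn e a c f p * conn e b f a p =
      ∑ a, ∑ f, conn e b a f p * conn e f c a p := by
    rw [Finset.sum_comm]
    exact Finset.sum_congr rfl fun a _ ↦ Finset.sum_congr rfl fun f _ ↦ mul_comm _ _
  rw [h1, h2]
  ring

/-- The components of the Hessian in a frame. -/
theorem hessian_eq_sum (he : IsOrthonormalFrameOn U e) (hp : p ∈ U) (hf : FunSmoothNear d f p)
    (u v : TangentSpace (𝓡 d) p) :
    hessian f p u v = ∑ b, ∑ c, (inner ℝ (e b p) u * inner ℝ (e c p) v) *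
      (mvfderiv (𝓡 d) (fun q ↦ mvfderiv (𝓡 d) f q (e c q)) p (e b p)
        - ∑ a, conn e b c a p * mvfderiv (𝓡 d) f p (e a p)) := by
  have hs := he.smoothNear p hp
  have h1 : hessian f p u v = ∑ c, inner ℝ (e c p) v *
      (mvfderiv (𝓡 d) (fun q ↦ mvfderiv (𝓡 d) f q (e c q)) p u
        - mvfderiv (𝓡 d) f p (leviCivita (extendField u) (e c) p)) := by
    have hu := smoothNear_extendField u
    -- The two Leibniz terms in `V` cancel, so the Hessian is tensorial in its second argument.
    have h := he.tensorial_eq_sum hp (fun V ↦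
      mvfderiv (𝓡 d) (fun q ↦ mvfderiv (𝓡 d) f q (V q)) p u
        - mvfderiv (𝓡 d) f p (leviCivita (extendField u) V p))
      (fun (V V' : (p : M) → TangentSpace (𝓡 d) p) h ↦ by
        have e1 : (fun q ↦ mvfderiv (𝓡 d) f q (V q)) =ᶠ[𝓝 p]
            fun q ↦ mvfderiv (𝓡 d) f q (V' q) := by
          filter_upwards [h] with q hq; rw [hq]
        rw [leviCivita_congr (X := extendField u) (X' := extendField u) (Y := V) (Y' := V')
          (EventuallyEq.refl _ _) h, mvfderiv_congr e1])
      (fun V V' h h' ↦ by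
        simp only [Pi.add_apply, map_add]
        rw [leviCivita_add_right hu.fieldDiffAt h.fieldDiffAt h'.fieldDiffAt,
          mvfderiv_fun_add (he.funSmoothNear_mvfderiv hp hf h).mdifferentiableAt
            (he.funSmoothNear_mvfderiv hp hf h').mdifferentiableAt, map_add, add_apply]
        ring)
      (fun g V hg h ↦ by
        simp only [Pi.smul_apply', map_smul, smul_eq_mul]
        rw [leviCivita_smul_right hg.mdifferentiableAt hu.fieldDiffAt h.fieldDiffAt,
          mvfderiv_fun_mul hg.mdifferentiableAt (he.funSmoothNear_mvfderiv hp hf h).mdifferentiableAt]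
        simp only [map_add, map_smul, add_apply,
          smul_apply, smul_eq_mul, extendField_self]
        ring) (smoothNear_extendField v)
    simpa only [hessian, extendField_self, smul_eq_mul] using h
  rw [h1, Finset.sum_comm]
  refine Finset.sum_congr rfl fun c _ ↦ ?_
  have h2 : ∀ b, mvfderiv (𝓡 d) f p (leviCivita (e b) (e c) p) =
      ∑ a, conn e b c a p * mvfderiv (𝓡 d) f p (e a p) := fun b ↦ by
    conv_lhs => rw [← he.sum_inner_smul hp (leviCivita (e b) (e c) p)]
    simp only [map_sum, map_smul, smul_eq_mul]
    rfl
  rw [he.leviCivita_eq_sum hp (smoothNear_extendField u) (hs c)]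
  conv_lhs =>
    enter [2, 1]
    rw [← he.sum_inner_smul hp u]
  simp only [extendField_self, map_sum, map_smul, smul_eq_mul, h2]
  rw [← Finset.sum_sub_distrib, Finset.mul_sum]
  exact Finset.sum_congr rfl fun b _ ↦ by ring

end IsOrthonormalFrameOn
end FrameFormulas

/-! ### Structure functions of a frame and the Jacobi identity -/

section StructureFunctions
open VectorField Filter Topology

set_option linter.unusedSectionVars false

variable {d : ℕ} {M : Type*} [TopologicalSpace M]
  [ChartedSpace (EuclideanSpace ℝ (Fin d)) M] [IsManifold (𝓡 d) ∞ M]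
  [RiemannianBundle (fun p : M ↦ TangentSpace (𝓡 d) p)]
  [IsContMDiffRiemannianBundle (𝓡 d) ∞ (EuclideanSpace ℝ (Fin d))
      (fun p : M ↦ TangentSpace (𝓡 d) p)]
  {X : (p : M) → TangentSpace (𝓡 d) p} {p : M}

namespace IsOrthonormalFrameOn
variable {ι : Type*} [Fintype ι] [Nonempty ι] {U : Set M} {e : ι → (p : M) → TangentSpace (𝓡 d) p}

/-- The structure functions of a frame: the components of the Lie brackets of its fields. -/
def structCoeff (e : ι → (p : M) → TangentSpace (𝓡 d) p) (a b c : ι) (q : M) : ℝ :=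
  inner ℝ (e c q) (mlieBracket (𝓡 d) (e a) (e b) q)

theorem mvfderiv_inner_eq_zero (he : IsOrthonormalFrameOn U e) (hp : p ∈ U) (a b : ι) :
    mvfderiv (𝓡 d) (fun q ↦ inner ℝ (e a q) (e b q)) p = 0 := by
  classical
  have : (fun q ↦ inner ℝ (e a q) (e b q)) =ᶠ[𝓝 p] fun _ ↦ if a = b then (1 : ℝ) else 0 := by
    filter_upwards [he.isOpen.mem_nhds hp] with q hq
    exact orthonormal_iff_ite.1 (he.orthonormal q hq) a b
  rw [mvfderiv_congr this, mvfderiv_const]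

/-- Koszul's formula in an orthonormal frame. -/
theorem conn_eq (he : IsOrthonormalFrameOn U e) (hp : p ∈ U) (a b c : ι) :
    conn e a b c p =
      1 / 2 * (structCoeff e a b c p - structCoeff e a c b p - structCoeff e b c a p) := by
  have hs := fun a ↦ (he.smoothNear p hp a).fieldDiffAt
  rw [conn, real_inner_comm, inner_leviCivita (hs a) (hs b) (hs c), koszul]
  simp only [he.mvfderiv_inner_eq_zero hp, structCoeff, real_inner_comm, zero_apply]
  ring

/-- Bracket version of `inner_leviCivita_sum`, by the same cancellation; it expands the nested
brackets of the Jacobi identity. -/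
theorem inner_mlieBracket_sum (he : IsOrthonormalFrameOn U e) (hp : p ∈ U) (a b : ι)
    (hX : SmoothNear X p) :
    inner ℝ (e b p) (mlieBracket (𝓡 d) (e a) X p) =
      mvfderiv (𝓡 d) (fun q ↦ inner ℝ (e b q) (X q)) p (e a p) +
        ∑ c, inner ℝ (e c p) (X p) * structCoeff e a c b p := by
  have hs := he.smoothNear p hp
  have h := he.tensorial_eq_sum hp
    (fun X ↦ inner ℝ (e b p) (mlieBracket (𝓡 d) (e a) X p) -
      mvfderiv (𝓡 d) (fun q ↦ inner ℝ (e b q) (X q)) p (e a p))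
    (fun (X X' : (p : M) → TangentSpace (𝓡 d) p) h ↦ by
      have e1 : (fun q ↦ inner ℝ (e b q) (X q)) =ᶠ[𝓝 p] fun q ↦ inner ℝ (e b q) (X' q) := by
        filter_upwards [h] with q hq; rw [hq]
      rw [EventuallyEq.mlieBracket_vectorField_eq (V := e a) (V₁ := e a) (W₁ := X) (W := X')
        (EventuallyEq.refl _ _) h, mvfderiv_congr e1])
    (fun X X' h h' ↦ by
      simp only [Pi.add_apply, inner_add_right]
      rw [mlieBracket_add_right h.fieldDiffAt h'.fieldDiffAt,
        mvfderiv_fun_add ((hs b).inner h).mdifferentiableAt ((hs b).inner h').mdifferentiableAt,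
        inner_add_right, add_apply]
      ring)
    (fun f X hf h ↦ by
      simp only [Pi.smul_apply', inner_smul_right]
      rw [mlieBracket_smul_right hf.mdifferentiableAt h.fieldDiffAt,
        mvfderiv_fun_mul hf.mdifferentiableAt ((hs b).inner h).mdifferentiableAt]
      simp only [inner_add_right, inner_smul_right, add_apply, smul_apply, smul_eq_mul]
      ring) hX
  simp only [he.mvfderiv_inner_eq_zero hp, zero_apply, sub_zero, smul_eq_mul] at h
  rw [sub_eq_iff_eq_add'] at h
  exact h

/-- The Jacobi identity in terms of the structure functions of a frame. -/
theorem jacobi (he : IsOrthonormalFrameOn U e) (hp : p ∈ U) (a b c i : ι) :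
    mvfderiv (𝓡 d) (structCoeff e b c i) p (e a p)
        + ∑ f, structCoeff e b c f p * structCoeff e a f i p
      = mvfderiv (𝓡 d) (structCoeff e a c i) p (e b p)
        + ∑ f, structCoeff e a c f p * structCoeff e b f i p
        - (mvfderiv (𝓡 d) (structCoeff e a b i) p (e c p)
        + ∑ f, structCoeff e a b f p * structCoeff e c f i p) := by
  have : IsManifold (𝓡 d) (minSmoothness ℝ 3) M := by
    rw [minSmoothness_of_isRCLikeNormedField]; infer_instance
  have hs := he.smoothNear p hp
  have sm : ∀ a, ContMDiffAt (𝓡 d) ((𝓡 d).prod 𝓘(ℝ, EuclideanSpace ℝ (Fin d)))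
      (minSmoothness ℝ 2) (fun q ↦ (⟨q, e a q⟩ :
        TotalSpace (EuclideanSpace ℝ (Fin d)) (TangentSpace (𝓡 d) (M := M)))) p :=
    fun a ↦ (hs a).self_of_nhds.of_le (by
      rw [minSmoothness_of_isRCLikeNormedField]; exact ENat.LEInfty.out)
  have J := leibniz_identity_mlieBracket_apply (sm a) (sm b) (sm c)
  -- Afterwards every nested bracket has a frame field in its first slot, as `inner_mlieBracket_sum`
  -- requires.
  rw [mlieBracket_swap_apply (V := mlieBracket (𝓡 d) (e a) (e b))] at J
  have J' := congrArg (fun v ↦ inner ℝ (e i p) v) J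
  simp only [inner_add_right, inner_neg_right] at J'
  rw [he.inner_mlieBracket_sum hp _ _ ((hs b).mlieBracket (hs c)),
    he.inner_mlieBracket_sum hp _ _ ((hs a).mlieBracket (hs c)),
    he.inner_mlieBracket_sum hp _ _ ((hs a).mlieBracket (hs b))] at J'
  simp only [← structCoeff.eq_def] at J'
  linarith

end IsOrthonormalFrameOn
end StructureFunctions

/-! ### Structure functions and connection coefficients of the ansatz -/

/-- The labels of the fields of a frame `k, t, x_i, y_i`. -/
inductive FrameIndex (n : ℕ)
  | k : FrameIndex n
  | t : FrameIndex n
  | x : Fin n → FrameIndex n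
  | y : Fin n → FrameIndex n

namespace FrameIndex
variable {n : ℕ}

/-- The labels as a sum type. -/
def equivSum (n : ℕ) : FrameIndex n ≃ Fin 2 ⊕ (Fin n ⊕ Fin n) where
  toFun
    | k => .inl 0
    | t => .inl 1
    | x i => .inr (.inl i)
    | y i => .inr (.inr i)
  invFun
    | .inl 0 => k
    | .inl 1 => t
    | .inr (.inl i) => x i
    | .inr (.inr i) => y i
  left_inv a := by cases a <;> rfl
  right_inv a := by
    rcases a with a | a | a
    · fin_cases a <;> rfl
    · rfl
    · rfl

instance : Fintype (FrameIndex n) := Fintype.ofEquiv _ (equivSum n).symm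
instance : DecidableEq (FrameIndex n) := (equivSum n).decidableEq
instance : Nonempty (FrameIndex n) := ⟨k⟩

theorem sum_eq {A : Type*} [AddCommMonoid A] (F : FrameIndex n → A) :
    ∑ a, F a = F k + F t + ∑ i, F (x i) + ∑ i, F (y i) := by
  rw [← (equivSum n).symm.sum_comp F, Fintype.sum_sum_type, Fintype.sum_sum_type,
    Fin.sum_univ_two, ← add_assoc]
  rfl

/-- The component of `∇τ = k - t`. -/
def tauSign : FrameIndex n → ℝ
  | k => 1
  | t => -1
  | x _ => 0
  | y _ => 0

end FrameIndex

namespace FrameCoeffs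
variable {n : ℕ} {S : Type*}
open FrameIndex

/-- The structure functions of the ansatz. -/
def struct (c : FrameCoeffs n S) (s : S) : FrameIndex n → FrameIndex n → FrameIndex n → ℝ
  | k, t, k => c.L s
  | k, t, t => c.L s
  | t, k, k => -c.L s
  | t, k, t => -c.L s
  | x i, y j, k => if i = j then c.N i s else 0
  | x i, y j, t => if i = j then c.N i s else 0
  | y i, x j, k => if i = j then -c.N i s else 0
  | y i, x j, t => if i = j then -c.N i s else 0
  | k, x i, x j => if i = j then c.A i s else 0
  | k, x i, y j => if i = j then c.B i s else 0
  | k, y i, x j => if i = j then c.C i s else 0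
  | k, y i, y j => if i = j then c.D i s else 0
  | t, x i, x j => if i = j then c.E i s else 0
  | t, x i, y j => if i = j then c.F i s else 0
  | t, y i, x j => if i = j then c.G i s else 0
  | t, y i, y j => if i = j then c.H i s else 0
  | x i, k, x j => if i = j then -c.A i s else 0
  | x i, k, y j => if i = j then -c.B i s else 0
  | y i, k, x j => if i = j then -c.C i s else 0
  | y i, k, y j => if i = j then -c.D i s else 0
  | x i, t, x j => if i = j then -c.E i s else 0
  | x i, t, y j => if i = j then -c.F i s else 0
  | y i, t, x j => if i = j then -c.G i s else 0
  | y i, t, y j => if i = j then -c.H i s else 0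
  | _, _, _ => 0

/-- The connection coefficients of the ansatz: `gamma a b c` is the `c`-component of the covariant
derivative of the field `b` along the field `a`. -/
def gamma (c : FrameCoeffs n S) (s : S) : FrameIndex n → FrameIndex n → FrameIndex n → ℝ
  | k, k, t => -c.L s
  | k, t, k => c.L s
  | t, k, t => -c.L s
  | t, t, k => c.L s
  | k, x i, y j => if i = j then c.H i s - c.C i s else 0
  | k, y i, x j => if i = j then c.C i s - c.H i s else 0
  | t, x i, y j => if i = j then c.F i s - c.A i s else 0
  | t, y i, x j => if i = j then c.A i s - c.F i s else 0
  | x i, k, x j => if i = j then -c.A i s else 0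
  | x i, k, y j => if i = j then c.E i s else 0
  | x i, t, x j => if i = j then -c.E i s else 0
  | x i, t, y j => if i = j then -c.A i s else 0
  | y i, k, x j => if i = j then -c.H i s else 0
  | y i, k, y j => if i = j then -c.D i s else 0
  | y i, t, x j => if i = j then c.D i s else 0
  | y i, t, y j => if i = j then -c.H i s else 0
  | x i, x j, k => if i = j then c.A i s else 0
  | x i, x j, t => if i = j then c.E i s else 0
  | x i, y j, k => if i = j then -c.E i s else 0
  | x i, y j, t => if i = j then c.A i s else 0
  | y i, y j, k => if i = j then c.D i s else 0
  | y i, y j, t => if i = j then c.H i s else 0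
  | y i, x j, k => if i = j then c.H i s else 0
  | y i, x j, t => if i = j then -c.D i s else 0
  | _, _, _ => 0

/-- The linear relations between the coefficient functions of the ansatz. -/
structure LinearRelations (c : FrameCoeffs n S) (s : S) : Prop where
  rel_AD : ∀ i, c.A i s - c.D i s = c.F i s + c.G i s
  rel_BC : ∀ i, c.B i s + c.C i s = c.H i s - c.E i s
  rel_N : ∀ i, c.N i s = c.A i s + c.D i s
  rel_N' : ∀ i, c.N i s = -(c.E i s + c.H i s)

/-- The linear relations collapse the half-sums in Koszul's formula to the short entries of `gamma`.
In that table ∇J = 0 is visible: J maps each derivative of k to that of t, and each derivative of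
x_i to that of y_i. -/
theorem LinearRelations.gamma_eq {c : FrameCoeffs n S} {s : S} (h : c.LinearRelations s)
    (a b d : FrameIndex n) :
    c.gamma s a b d = 1 / 2 * (c.struct s a b d - c.struct s a d b - c.struct s b d a) := by
  cases a <;> cases b <;> cases d <;> simp only [gamma, struct] <;> try ring1
  all_goals
    rename_i i j
    rcases eq_or_ne i j with rfl | hij
    · have h1 := h.rel_AD i
      have h2 := h.rel_BC i
      have h3 := h.rel_N i
      have h4 := h.rel_N' i
      simp only [if_true]
      linarith
    · simp only [if_neg hij, if_neg hij.symm]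
      ring

end FrameCoeffs

/-! ### The geometric frame realises the tables `struct` and `gamma` -/

section FrameGeometry
open VectorField Filter Topology FrameIndex IsOrthonormalFrameOn

set_option linter.unusedSectionVars false

variable {n : ℕ} {M : Type*} [TopologicalSpace M]
  [ChartedSpace (EuclideanSpace ℝ (Fin (2 * n + 2))) M]

/-- The fields of a frame, indexed by their labels. -/
def FrameFields.field (e : FrameFields n M) :
    FrameIndex n → (p : M) → TangentSpace (𝓡 (2 * n + 2)) p
  | .k => e.k
  | .t => e.t
  | .x i => e.x i
  | .y i => e.y i

theorem FrameFields.field_eq_family (e : FrameFields n M) (a : FrameIndex n) :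
    e.field a = e.family (equivSum n a) := by
  cases a <;> rfl

variable [IsManifold (𝓡 (2 * n + 2)) ∞ M]
  [RiemannianBundle (fun p : M ↦ TangentSpace (𝓡 (2 * n + 2)) p)]
  {U : Set M} {e : FrameFields n M} {c : FrameCoeffs n M} {p : M}

theorem IsKahlerFrameOn.linearRelations (he : IsKahlerFrameOn U e c) (hp : p ∈ U) :
    c.LinearRelations p :=
  ⟨he.rel_AD p hp, he.rel_BC p hp, he.rel_N p hp, he.rel_N' p hp⟩

theorem IsKahlerFrameOn.mlieBracket_eq (he : IsKahlerFrameOn U e c) (hp : p ∈ U)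
    (a b : FrameIndex n) :
    mlieBracket (𝓡 (2 * n + 2)) (e.field a) (e.field b) p =
      ∑ d, c.struct p a b d • e.field d p := by
  rw [FrameIndex.sum_eq]
  cases a <;> cases b <;>
    simp only [FrameCoeffs.struct, FrameFields.field, zero_smul, Finset.sum_const_zero, add_zero,
      zero_add, ite_smul, Finset.sum_ite_eq, Finset.mem_univ, if_true, mlieBracket_self,
      Pi.zero_apply]
  · rw [he.lie_kt p hp, smul_add]
  · exact he.lie_kx p hp _
  · exact he.lie_ky p hp _
  · rw [mlieBracket_swap_apply, he.lie_kt p hp, neg_smul, neg_smul, smul_add, neg_add]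
  · exact he.lie_tx p hp _
  · exact he.lie_ty p hp _
  · rw [mlieBracket_swap_apply, he.lie_kx p hp, neg_smul, neg_smul, neg_add]
  · rw [mlieBracket_swap_apply, he.lie_tx p hp, neg_smul, neg_smul, neg_add]
  · rename_i i j
    rcases eq_or_ne i j with rfl | hij
    · simp
    · exact he.lie_xx p hp i j hij
  · rename_i i j
    rcases eq_or_ne i j with rfl | hij
    · simp [he.lie_xy p hp]
    · simp [he.lie_xy_ne p hp i j hij, hij]
  · rw [mlieBracket_swap_apply, he.lie_ky p hp, neg_smul, neg_smul, neg_add]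
  · rw [mlieBracket_swap_apply, he.lie_ty p hp, neg_smul, neg_smul, neg_add]
  · rename_i i j
    rw [mlieBracket_swap_apply]
    rcases eq_or_ne i j with rfl | hij
    · simp [he.lie_xy p hp]
      abel
    · simp [he.lie_xy_ne p hp j i hij.symm, hij]
  · rename_i i j
    rcases eq_or_ne i j with rfl | hij
    · simp
    · exact he.lie_yy p hp i j hij

theorem IsKahlerFrameOn.orthonormal_field (he : IsKahlerFrameOn U e c) (hp : p ∈ U) :
    Orthonormal ℝ fun a ↦ e.field a p := by
  simp only [e.field_eq_family]
  exact (he.orthonormal p hp).comp _ (equivSum n).injective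

theorem IsKahlerFrameOn.structCoeff_eq (he : IsKahlerFrameOn U e c) (hp : p ∈ U)
    (a b d : FrameIndex n) : structCoeff e.field a b d p = c.struct p a b d := by
  rw [structCoeff, he.mlieBracket_eq hp]
  exact (he.orthonormal_field hp).inner_right_fintype _ d

variable [IsContMDiffRiemannianBundle (𝓡 (2 * n + 2)) ∞ (EuclideanSpace ℝ (Fin (2 * n + 2)))
      (fun p : M ↦ TangentSpace (𝓡 (2 * n + 2)) p)]

/-- Spanning follows by counting: 2n + 2 independent vectors in dimension 2n + 2. -/
theorem IsKahlerFrameOn.isOrthonormalFrameOn (he : IsKahlerFrameOn U e c) (hU : IsOpen U) :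
    IsOrthonormalFrameOn U e.field where
  isOpen := hU
  smoothNear p hp a := by
    filter_upwards [hU.mem_nhds hp] with q hq
    rw [e.field_eq_family]
    exact (he.smooth (equivSum n a)).contMDiffAt (hU.mem_nhds hq)
  orthonormal p hp := he.orthonormal_field hp
  span_eq_top p hp := by
    refine (he.orthonormal_field hp).linearIndependent.span_eq_top_of_card_eq_finrank ?_
    have h : Module.finrank ℝ (TangentSpace (𝓡 (2 * n + 2)) p) = 2 * n + 2 :=
      finrank_euclideanSpace_fin (𝕜 := ℝ)
    rw [h, Fintype.card_congr (equivSum n)]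
    simp
    ring

theorem IsKahlerFrameOn.conn_eq_gamma (he : IsKahlerFrameOn U e c) (hU : IsOpen U) (hp : p ∈ U)
    (a b d : FrameIndex n) : conn e.field a b d p = c.gamma p a b d := by
  rw [(he.isOrthonormalFrameOn hU).conn_eq hp, (he.linearRelations hp).gamma_eq]
  simp only [he.structCoeff_eq hp]

end FrameGeometry

/-! ### Derivatives of functions of τ -/

section Tau
open VectorField Filter Topology FrameIndex IsOrthonormalFrameOn

set_option linter.unusedSectionVars false

variable {n : ℕ} {M : Type*} [TopologicalSpace M]
  [ChartedSpace (EuclideanSpace ℝ (Fin (2 * n + 2))) M] [IsManifold (𝓡 (2 * n + 2)) ∞ M]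
  [RiemannianBundle (fun p : M ↦ TangentSpace (𝓡 (2 * n + 2)) p)]
  {U : Set M} {e : FrameFields n M} {τ : M → ℝ} {c : FrameCoeffs n ℝ} {p : M} {g : ℝ → ℝ}

theorem IsTauOn.mvfderiv_field (hτ : IsTauOn U e τ) (he : IsKahlerFrameOn U e (c.comp τ))
    (hp : p ∈ U) (a : FrameIndex n) :
    mvfderiv (𝓡 (2 * n + 2)) τ p (e.field a p) = tauSign a := by
  have ho := orthonormal_iff_ite.1 (he.orthonormal_field hp)
  rw [hτ.grad p hp, inner_sub_left]
  have hk := ho .k a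
  have ht := ho .t a
  simp only [FrameFields.field] at hk ht
  cases a <;> simp_all [FrameFields.field, tauSign]

theorem IsTauOn.contMDiffAt (hτ : IsTauOn U e τ) (hU : IsOpen U) (hp : p ∈ U) :
    ContMDiffAt (𝓡 (2 * n + 2)) 𝓘(ℝ, ℝ) ∞ τ p :=
  hτ.smooth.contMDiffAt (hU.mem_nhds hp)

theorem IsTauOn.mvfderiv_comp (hτ : IsTauOn U e τ) (hU : IsOpen U) (hp : p ∈ U)
    (hg : DifferentiableAt ℝ g (τ p)) (v : TangentSpace (𝓡 (2 * n + 2)) p) :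
    mvfderiv (𝓡 (2 * n + 2)) (fun q ↦ g (τ q)) p v =
      deriv g (τ p) * mvfderiv (𝓡 (2 * n + 2)) τ p v := by
  have h := mvfderiv_comp_apply (I' := 𝓡 (2 * n + 2)) (I := 𝓘(ℝ, ℝ)) (f := τ) (g := g) p
    hg.mdifferentiableAt ((hτ.contMDiffAt hU hp).mdifferentiableAt (by simp)) v
  refine h.trans ?_
  simp only [mvfderiv, ContinuousLinearMap.comp_apply, mfderiv_eq_fderiv]
  exact (fderiv_eq_smul_deriv (f := g) (x := τ p) (mvfderiv (𝓡 (2 * n + 2)) τ p v)).trans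
    (mul_comm _ _)

/-- The image of `τ` is open, since `τ` is a submersion. -/
theorem IsTauOn.isOpen_image (hτ : IsTauOn U e τ) (he : IsKahlerFrameOn U e (c.comp τ))
    (hU : IsOpen U) : IsOpen (τ '' U) := by
  rw [isOpen_iff_mem_nhds]
  rintro _ ⟨p, hp, rfl⟩
  have hs := hτ.contMDiffAt hU hp
  have hd := hs.mdifferentiableAt (by simp)
  have hw : writtenInExtChartAt (𝓡 (2 * n + 2)) 𝓘(ℝ, ℝ) p τ =
      τ ∘ (extChartAt (𝓡 (2 * n + 2)) p).symm := by
    ext z; simp [writtenInExtChartAt, chartAt_self_eq]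
  have h1 : ContDiffAt ℝ ∞ (τ ∘ (extChartAt (𝓡 (2 * n + 2)) p).symm)
      (extChartAt (𝓡 (2 * n + 2)) p p) := by
    have := (contMDiffAt_iff.1 hs).2
    rw [modelWithCornersSelf_coe, Set.range_id, contDiffWithinAt_univ] at this
    rw [← hw]
    exact this
  have h2 := h1.hasStrictFDerivAt (by simp)
  have h3 : (fderiv ℝ (τ ∘ (extChartAt (𝓡 (2 * n + 2)) p).symm)
      (extChartAt (𝓡 (2 * n + 2)) p p)).range = ⊤ := by
    rw [LinearMap.range_eq_top]
    have h4 := hτ.mvfderiv_field he hp .k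
    rw [hd.mvfderiv, hw, modelWithCornersSelf_coe, Set.range_id, fderivWithin_univ] at h4
    intro r
    -- The derivative of τ along k is 1, so r • k is sent to r.
    refine ⟨r • (show EuclideanSpace ℝ (Fin (2 * n + 2)) from e.field .k p), ?_⟩
    refine (map_smul _ _ _).trans ?_
    refine (congrArg (fun z : ℝ ↦ r • z) h4).trans ?_
    simp [tauSign]
  -- A strictly differentiable map with surjective derivative sends neighbourhoods onto
  -- neighbourhoods.
  have h5 := h2.map_nhds_eq_of_surj h3
  have h6 : τ '' U ∈ map (τ ∘ (extChartAt (𝓡 (2 * n + 2)) p).symm)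
      (𝓝 (extChartAt (𝓡 (2 * n + 2)) p p)) := by
    have h7 := continuousAt_extChartAt_symm (I := 𝓡 (2 * n + 2)) p
    rw [ContinuousAt, extChartAt_to_inv] at h7
    rw [mem_map]
    filter_upwards [h7.eventually (hU.mem_nhds hp)] with z hz
    exact ⟨_, hz, rfl⟩
  rw [h5] at h6
  simpa using h6

end Tau

/-! ### Algebra at one value of τ: consequences of Jacobi and the Ricci components -/

namespace FrameCoeffs
open FrameIndex
variable {n : ℕ}

/-- The relations satisfied by the coefficient functions `c` of the ansatz and their derivatives
`c'` at `s`: the linear relations, their derivatives, and the Jacobi identity. -/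
structure StructureEquations (c c' : FrameCoeffs n ℝ) (s : ℝ) : Prop where
  linear : c.LinearRelations s
  linear' : c'.LinearRelations s
  jacobi : ∀ a b d i, tauSign a * c'.struct s b d i + ∑ f, c.struct s b d f * c.struct s a f i =
    tauSign b * c'.struct s a d i + ∑ f, c.struct s a d f * c.struct s b f i
      - (tauSign d * c'.struct s a b i + ∑ f, c.struct s a b f * c.struct s d f i)

/-- The components of the Ricci tensor of the ansatz. -/
def ricciCoeff (c c' : FrameCoeffs n ℝ) (s : ℝ) (b d : FrameIndex n) : ℝ :=
  ∑ a, (c'.gamma s b d a * tauSign a - c'.gamma s a d a * tauSign b)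
    + ∑ f, c.gamma s b d f * ∑ a, c.gamma s a f a
    - ∑ a, ∑ f, c.gamma s a b f * c.gamma s f d a

/-- The divergences of the frame fields. -/
def div (c : FrameCoeffs n ℝ) (s : ℝ) : FrameIndex n → ℝ
  | k => -c.L s - ∑ j, c.N j s
  | t => c.L s + ∑ j, c.N j s
  | x _ => 0
  | y _ => 0

/-- Both expressions for N_i, as A_i + D_i and as -(E_i + H_i), enter here; they make the
divergences of k and t opposite. -/
theorem LinearRelations.sum_gamma {c : FrameCoeffs n ℝ} {s : ℝ} (h : c.LinearRelations s)
    (f : FrameIndex n) : ∑ a, c.gamma s a f a = c.div s f := by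
  have h1 : ∑ j, c.N j s = ∑ j, c.A j s + ∑ j, c.D j s := by
    rw [← Finset.sum_add_distrib]
    exact Finset.sum_congr rfl fun j _ ↦ h.rel_N j
  have h2 : ∑ j, c.N j s = -∑ j, c.E j s - ∑ j, c.H j s := by
    rw [← Finset.sum_neg_distrib, ← Finset.sum_sub_distrib]
    exact Finset.sum_congr rfl fun j _ ↦ by rw [h.rel_N' j]; ring
  cases f <;> simp only [FrameIndex.sum_eq, gamma, div, if_true, Finset.sum_neg_distrib,
    Finset.sum_const_zero] <;> linarith

/-- Solves the linear relations for N, G, H, C, leaving A, B, D, E, F free, so that later identities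
become polynomial identities in free variables. -/
theorem LinearRelations.params {c : FrameCoeffs n ℝ} {s : ℝ} (h : c.LinearRelations s)
    (i : Fin n) : c.N i s = c.A i s + c.D i s ∧ c.G i s = c.A i s - c.D i s - c.F i s ∧
      c.H i s = -c.A i s - c.D i s - c.E i s ∧
      c.C i s = -c.A i s - c.D i s - 2 * c.E i s - c.B i s := by
  have h1 := h.rel_AD i
  have h2 := h.rel_BC i
  have h3 := h.rel_N i
  have h4 := h.rel_N' i
  refine ⟨?_, ?_, ?_, ?_⟩ <;> linarith

/-- The potential of the Ricci form of the ansatz. -/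
def psi (c : FrameCoeffs n ℝ) (s : ℝ) : ℝ :=
  2 * c.L s + ∑ j, (c.C j s - c.H j s + c.A j s - c.F j s)

namespace StructureEquations
variable {c c' : FrameCoeffs n ℝ} {s : ℝ}

/-- Both sides are the k-component of [k, [x_i, y_i]]: computed directly, and via [k, x_i] and [k,
y_i], which give (A_i + D_i) N_i. It is this relation that makes the k, t part of the soliton
equation redundant. -/
theorem jacobi_kxy (h : StructureEquations c c' s) (i : Fin n) :
    c'.N i s + c.L s * c.N i s = c.N i s ^ 2 := by
  have J := h.jacobi k (x i) (y i) k
  simp [FrameIndex.sum_eq, struct, tauSign] at J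
  have h3 := h.linear.rel_N i
  linear_combination J - c.N i s * h3

theorem jacobi_ktx (h : StructureEquations c c' s) (i : Fin n) :
    c'.A i s + c'.E i s = c.L s * (c.A i s + c.E i s) - c.F i s * c.C i s + c.B i s * c.G i s ∧
    c'.B i s + c'.F i s = c.L s * (c.B i s + c.F i s) - c.E i s * c.B i s - c.F i s * c.D i s
      + c.A i s * c.F i s + c.B i s * c.H i s := by
  have J1 := h.jacobi k t (x i) (x i)
  have J2 := h.jacobi k t (x i) (y i)
  simp [FrameIndex.sum_eq, struct, tauSign] at J1 J2
  constructor <;> linarith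

theorem jacobi_kty (h : StructureEquations c c' s) (i : Fin n) :
    c'.C i s + c'.G i s = c.L s * (c.C i s + c.G i s) - c.G i s * c.A i s - c.H i s * c.C i s
      + c.C i s * c.E i s + c.D i s * c.G i s ∧
    c'.D i s + c'.H i s = c.L s * (c.D i s + c.H i s) - c.G i s * c.B i s + c.C i s * c.F i s := by
  have J1 := h.jacobi k t (y i) (x i)
  have J2 := h.jacobi k t (y i) (y i)
  simp [FrameIndex.sum_eq, struct, tauSign] at J1 J2
  constructor <;> linarith

/-- For i ≠ j the field x_i commutes with x_j and y_j, hence with [x_j, y_j] = N_j (k + t); as N_j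
is constant along x_i, this gives N_j [k + t, x_i] = 0. The same holds for y_i. -/
theorem jacobi_ne (h : StructureEquations c c' s) {i j : Fin n} (hij : i ≠ j) :
    c.N j s * (c.A i s + c.E i s) = 0 ∧ c.N j s * (c.B i s + c.F i s) = 0 ∧
    c.N j s * (c.C i s + c.G i s) = 0 ∧ c.N j s * (c.D i s + c.H i s) = 0 := by
  have J1 := h.jacobi (x i) (x j) (y j) (x i)
  have J2 := h.jacobi (x i) (x j) (y j) (y i)
  have J3 := h.jacobi (y i) (x j) (y j) (x i)
  have J4 := h.jacobi (y i) (x j) (y j) (y i)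
  simp [FrameIndex.sum_eq, struct, tauSign, hij, hij.symm] at J1 J2 J3 J4
  refine ⟨?_, ?_, ?_, ?_⟩ <;> linarith

theorem ricciCoeff_eq (h : StructureEquations c c' s) (b d : FrameIndex n) :
    c.ricciCoeff c' s b d = ∑ a, c'.gamma s b d a * tauSign a - c'.div s d * tauSign b
      + ∑ f, c.gamma s b d f * c.div s f - ∑ a, ∑ f, c.gamma s a b f * c.gamma s f d a := by
  simp only [ricciCoeff, Finset.sum_sub_distrib, ← Finset.sum_mul, h.linear.sum_gamma,
    h.linear'.sum_gamma]

/-- The derivatives of `A + D`, `A + E`, `B + F` and `C + G`. -/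
theorem jacobi_params (h : StructureEquations c c' s) (i : Fin n) :
    c'.A i s + c'.D i s + c.L s * (c.A i s + c.D i s) = (c.A i s + c.D i s) ^ 2 ∧
    c'.A i s + c'.E i s = c.L s * (c.A i s + c.E i s)
      + c.F i s * (c.A i s + c.D i s + 2 * c.E i s + c.B i s)
      + c.B i s * (c.A i s - c.D i s - c.F i s) ∧
    c'.B i s + c'.F i s = c.L s * (c.B i s + c.F i s) - c.E i s * c.B i s - c.F i s * c.D i s
      + c.A i s * c.F i s - c.B i s * (c.A i s + c.D i s + c.E i s) ∧
    c'.C i s + c'.G i s = c.L s * (c.C i s + c.G i s) - c.G i s * c.A i s - c.H i s * c.C i s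
      + c.C i s * c.E i s + c.D i s * c.G i s := by
  have h1 := h.jacobi_kxy i
  obtain ⟨h2, h3⟩ := h.jacobi_ktx i
  obtain ⟨e1, e2, e3, e4⟩ := h.linear.params i
  obtain ⟨e1', -, -, -⟩ := h.linear'.params i
  rw [e1, e1'] at h1
  rw [e2, e4] at h2
  rw [e3] at h3
  refine ⟨h1, ?_, ?_, (h.jacobi_kty i).1⟩ <;> linarith

/-- In the first two identities both sides equal N_i N_j, by `jacobi_ne` for (i, j) and (j, i) and
the linear relations. -/
theorem mul_N_of_ne (h : StructureEquations c c' s) {i j : Fin n} (hij : i ≠ j) :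
    (c.A i s - c.E i s) * c.N j s =
      c.N i s * (c.C j s - c.H j s + c.A j s - c.F j s) ∧
    (c.D i s - c.H i s) * c.N j s =
      c.N i s * (c.C j s - c.H j s + c.A j s - c.F j s) ∧
    (c.A i s + c.E i s) * c.N j s = 0 ∧ (c.D i s + c.H i s) * c.N j s = 0 := by
  obtain ⟨h1, h2, h3, h4⟩ := h.jacobi_ne hij
  obtain ⟨k1, k2, k3, k4⟩ := h.jacobi_ne hij.symm
  obtain ⟨e1, e2, e3, e4⟩ := h.linear.params i
  obtain ⟨f1, f2, f3, f4⟩ := h.linear.params j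
  simp only [e1, e2, e3, e4, f1, f2, f3, f4] at h1 h2 h3 h4 k1 k2 k3 k4 ⊢
  refine ⟨?_, ?_, ?_, ?_⟩ <;> linarith

/-- By `mul_N_of_ne` only the summand j = i survives. This lets each x_i, y_i block of the Ricci
tensor be computed from index i alone, apart from the two sums that enter ψ and the divergence. -/
theorem sum_N_eq (h : StructureEquations c c' s) (i : Fin n) :
    (c.A i s - c.E i s) * ∑ j, c.N j s - c.N i s * ∑ j, (c.C j s - c.H j s + c.A j s - c.F j s) =
      (c.A i s - c.E i s) * c.N i s - c.N i s * (c.C i s - c.H i s + c.A i s - c.F i s) ∧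
    (c.D i s - c.H i s) * ∑ j, c.N j s - c.N i s * ∑ j, (c.C j s - c.H j s + c.A j s - c.F j s) =
      (c.D i s - c.H i s) * c.N i s - c.N i s * (c.C i s - c.H i s + c.A i s - c.F i s) ∧
    (c.A i s + c.E i s) * ∑ j, c.N j s = (c.A i s + c.E i s) * c.N i s ∧
    (c.D i s + c.H i s) * ∑ j, c.N j s = (c.D i s + c.H i s) * c.N i s := by
  simp only [Finset.mul_sum, ← Finset.sum_sub_distrib]
  refine ⟨?_, ?_, ?_, ?_⟩ <;> refine Finset.sum_eq_single i (fun j _ hj ↦ ?_) (by simp) <;>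
    obtain ⟨h1, h2, h3, h4⟩ := h.mul_N_of_ne hj.symm
  · rw [h1, sub_self]
  · rw [h2, sub_self]
  · exact h3
  · exact h4

/-- Summand by summand, `key` trades the quadratic terms of the k, k entry for derivatives by the
Jacobi identity. The quadratic terms of the t, t entry are the same by `key'`: the difference is (A
+ D)² - (E + H)² = 0. -/
theorem ricciCoeff_kk_tt (h : StructureEquations c c' s) :
    c.ricciCoeff c' s k k = c'.psi s - c.L s * c.psi s ∧
    c.ricciCoeff c' s t t = c'.psi s - c.L s * c.psi s := by
  have key : ∑ j, c.A j s * c.A j s + ∑ j, c.D j s * c.D j s - ∑ j, c.E j s * c.H j s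
        - ∑ j, c.H j s * c.E j s =
      ∑ j, c'.N j s - c.L s * ∑ j, c.N j s
        - ∑ j, (c'.C j s - c'.H j s + c'.A j s - c'.F j s)
        + c.L s * ∑ j, (c.C j s - c.H j s + c.A j s - c.F j s) := by
    simp only [Finset.mul_sum, ← Finset.sum_sub_distrib, ← Finset.sum_add_distrib]
    refine Finset.sum_congr rfl fun j _ ↦ ?_
    obtain ⟨h1, h2, h3, h4⟩ := h.jacobi_params j
    obtain ⟨e1, e2, e3, e4⟩ := h.linear.params j
    obtain ⟨f1, f2, f3, f4⟩ := h.linear'.params j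
    simp only [e1, e2, e3, e4, f1, f2, f3, f4] at h4 ⊢
    linarith
  have key' : ∑ j, c.E j s * c.E j s + ∑ j, c.H j s * c.H j s - ∑ j, c.A j s * c.D j s
        - ∑ j, c.D j s * c.A j s =
      ∑ j, c.A j s * c.A j s + ∑ j, c.D j s * c.D j s - ∑ j, c.E j s * c.H j s
        - ∑ j, c.H j s * c.E j s := by
    simp only [← Finset.sum_sub_distrib, ← Finset.sum_add_distrib]
    refine Finset.sum_congr rfl fun j _ ↦ ?_
    rw [(h.linear.params j).2.2.1]
    ring
  simp only [h.ricciCoeff_eq, FrameIndex.sum_eq, gamma, tauSign, div, mul_zero, zero_mul, mul_one,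
    mul_neg, add_zero, zero_add, ite_mul, mul_ite, Finset.sum_ite_eq', Finset.mem_univ, if_true,
    Finset.sum_const_zero, neg_zero, psi]
  simp only [Finset.sum_add_distrib, neg_mul, neg_neg, Finset.sum_neg_distrib]
  constructor <;> linarith

/-- For each j the quadratic terms add up to (A + D)(E + H) = -N², which `jacobi_kxy` turns into -N'
- LN. -/
theorem ricciCoeff_kt (h : StructureEquations c c' s) :
    c.ricciCoeff c' s k t = 0 ∧ c.ricciCoeff c' s t k = 0 := by
  have key : ∑ j, c.A j s * c.E j s + ∑ j, c.E j s * c.D j s + ∑ j, c.H j s * c.A j s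
        + ∑ j, c.D j s * c.H j s = -∑ j, c'.N j s - c.L s * ∑ j, c.N j s := by
    simp only [Finset.mul_sum, ← Finset.sum_sub_distrib, ← Finset.sum_add_distrib,
      ← Finset.sum_neg_distrib]
    refine Finset.sum_congr rfl fun j _ ↦ ?_
    obtain ⟨h1, h2, h3, h4⟩ := h.jacobi_params j
    obtain ⟨e1, e2, e3, e4⟩ := h.linear.params j
    rw [e1, (h.linear'.params j).1, e3]
    linarith
  have key' : ∑ j, c.E j s * c.A j s + ∑ j, c.A j s * c.H j s + ∑ j, c.D j s * c.E j s
        + ∑ j, c.H j s * c.D j s = ∑ j, c.A j s * c.E j s + ∑ j, c.E j s * c.D j s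
        + ∑ j, c.H j s * c.A j s + ∑ j, c.D j s * c.H j s := by
    simp only [← Finset.sum_add_distrib]
    exact Finset.sum_congr rfl fun j _ ↦ by ring
  simp only [h.ricciCoeff_eq, FrameIndex.sum_eq, gamma, tauSign, div, mul_zero, zero_mul, mul_one,
    mul_neg, add_zero, zero_add, ite_mul, mul_ite, Finset.sum_ite_eq', Finset.mem_univ, if_true,
    Finset.sum_const_zero, neg_zero]
  simp only [Finset.sum_add_distrib, neg_mul, neg_neg]
  constructor <;> linarith

theorem ricciCoeff_xy (h : StructureEquations c c' s) (i : Fin n) :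
    c.ricciCoeff c' s (x i) (x i) = -c.N i s * c.psi s ∧
    c.ricciCoeff c' s (y i) (y i) = -c.N i s * c.psi s ∧
    c.ricciCoeff c' s (x i) (y i) = 0 ∧ c.ricciCoeff c' s (y i) (x i) = 0 := by
  obtain ⟨s1, s2, s3, s4⟩ := h.sum_N_eq i
  simp only [h.ricciCoeff_eq, FrameIndex.sum_eq, gamma, tauSign, div, mul_zero, zero_mul, mul_one,
    mul_neg, add_zero, zero_add, ite_mul, mul_ite, Finset.sum_ite_eq, Finset.sum_ite_eq',
    Finset.mem_univ, if_true,
    Finset.sum_const_zero, sub_zero, Finset.sum_add_distrib, psi]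
  -- The sums over all planes enter only through `sum_N_eq`; treated as opaque, they leave an
  -- identity for the single index i.
  generalize (∑ j, c.N j s) = SN at *
  generalize (∑ j, (c.C j s - c.H j s + c.A j s - c.F j s)) = SW at *
  obtain ⟨h1, h2, h3, h4⟩ := h.jacobi_params i
  obtain ⟨e1, e2, e3, e4⟩ := h.linear.params i
  obtain ⟨f1, f2, f3, f4⟩ := h.linear'.params i
  simp only [e1, e2, e3, e4, f2, f3, f4] at h4 s1 s2 s3 s4 ⊢
  refine ⟨?_, ?_, ?_, ?_⟩ <;> linarith

/-- No entry of `gamma` links the plane of x_i, y_i with that of x_j, y_j, so every term vanishes.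
-/
theorem ricciCoeff_block_ne (h : StructureEquations c c' s) {i j : Fin n} (hij : i ≠ j) :
    c.ricciCoeff c' s (x i) (x j) = 0 ∧ c.ricciCoeff c' s (y i) (y j) = 0 ∧
    c.ricciCoeff c' s (x i) (y j) = 0 ∧ c.ricciCoeff c' s (y i) (x j) = 0 := by
  simp only [h.ricciCoeff_eq, FrameIndex.sum_eq, gamma, tauSign, div, mul_zero, zero_mul, mul_one,
    mul_neg, add_zero, ite_mul, mul_ite, Finset.sum_ite_eq, Finset.sum_ite_eq',
    Finset.mem_univ, if_true, if_neg hij, if_neg hij.symm,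
    Finset.sum_const_zero, sub_zero, Finset.sum_add_distrib, neg_zero, and_self]

/-- Parity: nonzero entries of `gamma` carry zero or two labels of type x, y, and both `tauSign` and
`div` vanish on such labels. No term with exactly one free label of this type survives. -/
theorem ricciCoeff_mixed (h : StructureEquations c c' s) (i : Fin n) :
    c.ricciCoeff c' s k (x i) = 0 ∧ c.ricciCoeff c' s k (y i) = 0 ∧
    c.ricciCoeff c' s t (x i) = 0 ∧ c.ricciCoeff c' s t (y i) = 0 ∧
    c.ricciCoeff c' s (x i) k = 0 ∧ c.ricciCoeff c' s (y i) k = 0 ∧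
    c.ricciCoeff c' s (x i) t = 0 ∧ c.ricciCoeff c' s (y i) t = 0 := by
  simp only [h.ricciCoeff_eq, FrameIndex.sum_eq, gamma, tauSign, div, mul_zero, zero_mul, mul_one,
    mul_neg, add_zero, zero_add, mul_ite, Finset.sum_ite_eq, Finset.sum_ite_eq',
    Finset.mem_univ, if_true,
    Finset.sum_const_zero, sub_zero, neg_zero, and_self]

theorem ricciCoeff_ne (h : StructureEquations c c' s) {b d : FrameIndex n} (hbd : b ≠ d) :
    c.ricciCoeff c' s b d = 0 := by
  cases b <;> cases d
  case k.k | t.t => exact absurd rfl hbd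
  case k.t => exact h.ricciCoeff_kt.1
  case t.k => exact h.ricciCoeff_kt.2
  case x.x i j => exact (h.ricciCoeff_block_ne fun hij ↦ hbd (by rw [hij])).1
  case y.y i j => exact (h.ricciCoeff_block_ne fun hij ↦ hbd (by rw [hij])).2.1
  case x.y i j =>
    rcases eq_or_ne i j with rfl | hij
    · exact (h.ricciCoeff_xy i).2.2.1
    · exact (h.ricciCoeff_block_ne hij).2.2.1
  case y.x i j =>
    rcases eq_or_ne i j with rfl | hij
    · exact (h.ricciCoeff_xy i).2.2.2
    · exact (h.ricciCoeff_block_ne hij).2.2.2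
  all_goals simp only [h.ricciCoeff_mixed]

end StructureEquations
end FrameCoeffs

theorem FrameIndex.sum_mul_tauSign {n : ℕ} (F : FrameIndex n → ℝ) :
    ∑ a, F a * tauSign a = F k - F t := by
  simp only [FrameIndex.sum_eq, tauSign, mul_one, mul_zero, Finset.sum_const_zero, mul_neg,
    add_zero, sub_eq_add_neg]

/-! ### Differentiating the coefficient tables -/

namespace FrameCoeffs
open FrameIndex Filter Topology
variable {n : ℕ} {c c' : FrameCoeffs n ℝ} {s : ℝ} {S : Set ℝ}

/-- The derivatives of the coefficient functions. -/
def deriv (c : FrameCoeffs n ℝ) : FrameCoeffs n ℝ where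
  A i := _root_.deriv (c.A i)
  B i := _root_.deriv (c.B i)
  C i := _root_.deriv (c.C i)
  D i := _root_.deriv (c.D i)
  E i := _root_.deriv (c.E i)
  F i := _root_.deriv (c.F i)
  G i := _root_.deriv (c.G i)
  H i := _root_.deriv (c.H i)
  N i := _root_.deriv (c.N i)
  L := _root_.deriv c.L

/-- The functions `c'` are the derivatives of the coefficient functions `c` at `s`. -/
structure HasDerivAt (c c' : FrameCoeffs n ℝ) (s : ℝ) : Prop where
  A : ∀ i, _root_.HasDerivAt (fun s ↦ c.A i s) (c'.A i s) s
  B : ∀ i, _root_.HasDerivAt (fun s ↦ c.B i s) (c'.B i s) s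
  C : ∀ i, _root_.HasDerivAt (fun s ↦ c.C i s) (c'.C i s) s
  D : ∀ i, _root_.HasDerivAt (fun s ↦ c.D i s) (c'.D i s) s
  E : ∀ i, _root_.HasDerivAt (fun s ↦ c.E i s) (c'.E i s) s
  F : ∀ i, _root_.HasDerivAt (fun s ↦ c.F i s) (c'.F i s) s
  G : ∀ i, _root_.HasDerivAt (fun s ↦ c.G i s) (c'.G i s) s
  H : ∀ i, _root_.HasDerivAt (fun s ↦ c.H i s) (c'.H i s) s
  N : ∀ i, _root_.HasDerivAt (fun s ↦ c.N i s) (c'.N i s) s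
  L : _root_.HasDerivAt (fun s ↦ c.L s) (c'.L s) s

theorem SmoothOn.hasDerivAt (hc : c.SmoothOn S) (hS : IsOpen S) (hs : s ∈ S) :
    c.HasDerivAt c.deriv s := by
  have key : ∀ {g : ℝ → ℝ}, ContDiffOn ℝ ∞ g S → _root_.HasDerivAt g (_root_.deriv g s) s :=
    fun hg ↦ ((hg.contDiffAt (hS.mem_nhds hs)).differentiableAt (by simp)).hasDerivAt
  exact ⟨fun i ↦ key (hc.A i), fun i ↦ key (hc.B i), fun i ↦ key (hc.C i), fun i ↦ key (hc.D i),
    fun i ↦ key (hc.E i), fun i ↦ key (hc.F i), fun i ↦ key (hc.G i), fun i ↦ key (hc.H i),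
    fun i ↦ key (hc.N i), key hc.L⟩

theorem HasDerivAt.ite {P : Prop} [Decidable P] {g : ℝ → ℝ} {g' : ℝ}
    (h : _root_.HasDerivAt g g' s) :
    _root_.HasDerivAt (fun s ↦ if P then g s else 0) (if P then g' else 0) s := by
  split_ifs
  · exact h
  · exact hasDerivAt_const _ _

/-- The table depends linearly on the coefficients with constant factors, so its derivative is the
same table for `c'`. -/
theorem HasDerivAt.struct (h : c.HasDerivAt c' s) (a b d : FrameIndex n) :
    _root_.HasDerivAt (fun s ↦ c.struct s a b d) (c'.struct s a b d) s := by
  cases a <;> cases b <;> cases d <;> simp only [FrameCoeffs.struct] <;>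
    first
      | exact hasDerivAt_const _ _
      | exact h.L
      | exact h.L.fun_neg
      | refine HasDerivAt.ite ?_
        first
          | exact h.A _ | exact h.B _ | exact h.C _ | exact h.D _ | exact h.E _ | exact h.F _
          | exact h.G _ | exact h.H _ | exact h.N _
          | exact (h.A _).fun_neg | exact (h.B _).fun_neg | exact (h.C _).fun_neg
          | exact (h.D _).fun_neg | exact (h.E _).fun_neg | exact (h.F _).fun_neg
          | exact (h.G _).fun_neg | exact (h.H _).fun_neg | exact (h.N _).fun_neg

theorem HasDerivAt.gamma (h : c.HasDerivAt c' s) (a b d : FrameIndex n) :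
    _root_.HasDerivAt (fun s ↦ c.gamma s a b d) (c'.gamma s a b d) s := by
  cases a <;> cases b <;> cases d <;> simp only [FrameCoeffs.gamma] <;>
    first
      | exact hasDerivAt_const _ _
      | exact h.L
      | exact h.L.fun_neg
      | refine HasDerivAt.ite ?_
        first
          | exact h.A _ | exact h.D _ | exact h.E _ | exact h.H _
          | exact (h.A _).fun_neg | exact (h.D _).fun_neg | exact (h.E _).fun_neg
          | exact (h.H _).fun_neg
          | exact (h.H _).fun_sub (h.C _) | exact (h.C _).fun_sub (h.H _)
          | exact (h.F _).fun_sub (h.A _) | exact (h.A _).fun_sub (h.F _)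

theorem HasDerivAt.psi (h : c.HasDerivAt c' s) :
    _root_.HasDerivAt (fun s ↦ c.psi s) (c'.psi s) s :=
  (h.L.const_mul 2).fun_add (HasDerivAt.fun_sum fun j _ ↦
    (((h.C j).fun_sub (h.H j)).fun_add (h.A j)).fun_sub (h.F j))

/-- Identities valid near `s` may be differentiated; the neighbourhood is available because the
image of τ is open. -/
theorem HasDerivAt.linearRelations (h : c.HasDerivAt c' s)
    (hl : ∀ᶠ r in 𝓝 s, c.LinearRelations r) : c'.LinearRelations s where
  rel_AD i := ((h.A i).fun_sub (h.D i)).unique <|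
    ((h.F i).fun_add (h.G i)).congr_of_eventuallyEq (hl.mono fun _ hr ↦ hr.rel_AD i)
  rel_BC i := ((h.B i).fun_add (h.C i)).unique <|
    ((h.H i).fun_sub (h.E i)).congr_of_eventuallyEq (hl.mono fun _ hr ↦ hr.rel_BC i)
  rel_N i := (h.N i).unique <|
    ((h.A i).fun_add (h.D i)).congr_of_eventuallyEq (hl.mono fun _ hr ↦ hr.rel_N i)
  rel_N' i := (h.N i).unique <|
    ((h.E i).fun_add (h.H i)).fun_neg.congr_of_eventuallyEq (hl.mono fun _ hr ↦ hr.rel_N' i)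

/-- The eigenvalues of the Ricci tensor of the ansatz. -/
def ricciEigenvalue (c c' : FrameCoeffs n ℝ) (s : ℝ) : FrameIndex n → ℝ
  | k => c'.psi s - c.L s * c.psi s
  | t => c'.psi s - c.L s * c.psi s
  | x i => -c.N i s * c.psi s
  | y i => -c.N i s * c.psi s

theorem StructureEquations.ricciCoeff_eq_ite (h : StructureEquations c c' s)
    (b d : FrameIndex n) :
    c.ricciCoeff c' s b d = if b = d then c.ricciEigenvalue c' s b else 0 := by
  split_ifs with hbd
  · subst hbd
    cases b
    · exact h.ricciCoeff_kk_tt.1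
    · exact h.ricciCoeff_kk_tt.2
    · exact (h.ricciCoeff_xy _).1
    · exact (h.ricciCoeff_xy _).2.1
  · exact h.ricciCoeff_ne hbd

theorem comp_gamma {T : Type*} (c : FrameCoeffs n ℝ) (τ : T → ℝ) (p : T) :
    (c.comp τ).gamma p = c.gamma (τ p) := rfl

/-- The components of the Hessian of a function of `τ`. -/
def hessCoeff (c : FrameCoeffs n ℝ) (f : ℝ → ℝ) (s : ℝ) (b d : FrameIndex n) : ℝ :=
  _root_.deriv (_root_.deriv f) s * tauSign b * tauSign d
    - _root_.deriv f s * (c.gamma s b d k - c.gamma s b d t)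

end FrameCoeffs

/-! ### Ricci tensor and Hessian of the ansatz on the manifold -/

section Components
open VectorField Filter Topology FrameIndex IsOrthonormalFrameOn

set_option linter.unusedSectionVars false

variable {n : ℕ} {M : Type*} [TopologicalSpace M]
  [ChartedSpace (EuclideanSpace ℝ (Fin (2 * n + 2))) M] [IsManifold (𝓡 (2 * n + 2)) ∞ M]
  [RiemannianBundle (fun p : M ↦ TangentSpace (𝓡 (2 * n + 2)) p)]
  [IsContMDiffRiemannianBundle (𝓡 (2 * n + 2)) ∞ (EuclideanSpace ℝ (Fin (2 * n + 2)))
      (fun p : M ↦ TangentSpace (𝓡 (2 * n + 2)) p)]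
  {U : Set M} {e : FrameFields n M} {τ : M → ℝ} {c : FrameCoeffs n ℝ} {p : M} {f : ℝ → ℝ}

theorem IsTauOn.mvfderiv_structCoeff (hτ : IsTauOn U e τ) (hU : IsOpen U)
    (hc : c.SmoothOn (τ '' U)) (he : IsKahlerFrameOn U e (c.comp τ)) (hp : p ∈ U)
    (g a b d : FrameIndex n) :
    mvfderiv (𝓡 (2 * n + 2)) (structCoeff e.field a b d) p (e.field g p) =
      tauSign g * c.deriv.struct (τ p) a b d := by
  have h : structCoeff e.field a b d =ᶠ[𝓝 p] fun q ↦ c.struct (τ q) a b d := by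
    filter_upwards [hU.mem_nhds hp] with q hq
    exact he.structCoeff_eq hq a b d
  have hd := (hc.hasDerivAt (hτ.isOpen_image he hU) (Set.mem_image_of_mem τ hp)).struct a b d
  rw [mvfderiv_congr h, hτ.mvfderiv_comp (g := fun s ↦ c.struct s a b d) hU hp
    hd.differentiableAt, hd.deriv, hτ.mvfderiv_field he hp, mul_comm]

theorem IsTauOn.mvfderiv_conn (hτ : IsTauOn U e τ) (hU : IsOpen U)
    (hc : c.SmoothOn (τ '' U)) (he : IsKahlerFrameOn U e (c.comp τ)) (hp : p ∈ U)
    (g a b d : FrameIndex n) :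
    mvfderiv (𝓡 (2 * n + 2)) (conn e.field a b d) p (e.field g p) =
      c.deriv.gamma (τ p) a b d * tauSign g := by
  have h : conn e.field a b d =ᶠ[𝓝 p] fun q ↦ c.gamma (τ q) a b d := by
    filter_upwards [hU.mem_nhds hp] with q hq
    exact he.conn_eq_gamma hU hq a b d
  have hd := (hc.hasDerivAt (hτ.isOpen_image he hU) (Set.mem_image_of_mem τ hp)).gamma a b d
  rw [mvfderiv_congr h, hτ.mvfderiv_comp (g := fun s ↦ c.gamma s a b d) hU hp
    hd.differentiableAt, hd.deriv, hτ.mvfderiv_field he hp]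

theorem IsKahlerFrameOn.linearRelations_comp (he : IsKahlerFrameOn U e (c.comp τ)) {s : ℝ}
    (hs : s ∈ τ '' U) : c.LinearRelations s := by
  obtain ⟨p, hp, rfl⟩ := hs
  have h := he.linearRelations hp
  exact ⟨h.rel_AD, h.rel_BC, h.rel_N, h.rel_N'⟩

/-- The bridge from geometry to algebra: the Jacobi identity for the frame becomes a system in the
values and τ-derivatives of the coefficients. -/
theorem IsTauOn.structureEquations (hτ : IsTauOn U e τ) (hU : IsOpen U)
    (hc : c.SmoothOn (τ '' U)) (he : IsKahlerFrameOn U e (c.comp τ)) (hp : p ∈ U) :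
    c.StructureEquations c.deriv (τ p) where
  linear := he.linearRelations_comp (Set.mem_image_of_mem τ hp)
  linear' := (hc.hasDerivAt (hτ.isOpen_image he hU)
    (Set.mem_image_of_mem τ hp)).linearRelations <| by
      filter_upwards [(hτ.isOpen_image he hU).mem_nhds (Set.mem_image_of_mem τ hp)] with r hr
      exact he.linearRelations_comp hr
  jacobi a b d i := by
    have h := (he.isOrthonormalFrameOn hU).jacobi hp a b d i
    simp only [hτ.mvfderiv_structCoeff hU hc he hp, he.structCoeff_eq hp] at h
    exact h

/-- The Ricci tensor of the ansatz is diagonal in the frame. -/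
theorem IsTauOn.ricci_eq (hτ : IsTauOn U e τ) (hU : IsOpen U)
    (hc : c.SmoothOn (τ '' U)) (he : IsKahlerFrameOn U e (c.comp τ)) (hp : p ∈ U)
    (u v : TangentSpace (𝓡 (2 * n + 2)) p) :
    ricci p u v = ∑ b, ∑ d, (inner ℝ (e.field b p) u * inner ℝ (e.field d p) v) *
      if b = d then c.ricciEigenvalue c.deriv (τ p) b else 0 := by
  have ho := he.isOrthonormalFrameOn hU
  rw [ho.ricci_eq_sum hp]
  refine Finset.sum_congr rfl fun b _ ↦ Finset.sum_congr rfl fun d _ ↦ ?_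
  rw [← (hτ.structureEquations hU hc he hp).ricciCoeff_eq_ite, ho.sum_inner_curvature hp]
  simp only [hτ.mvfderiv_conn hU hc he hp, he.conn_eq_gamma hU hp, FrameCoeffs.comp_gamma]
  rfl

/-- The Hessian of a function of `τ` in the frame. -/
theorem IsTauOn.hessian_eq (hτ : IsTauOn U e τ) (hU : IsOpen U)
    (he : IsKahlerFrameOn U e (c.comp τ)) (hf : ContDiffOn ℝ ∞ f (τ '' U)) (hp : p ∈ U)
    (u v : TangentSpace (𝓡 (2 * n + 2)) p) :
    hessian (f ∘ τ) p u v = ∑ b, ∑ d, (inner ℝ (e.field b p) u * inner ℝ (e.field d p) v) *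
      c.hessCoeff f (τ p) b d := by
  have ho := he.isOrthonormalFrameOn hU
  have hS := hτ.isOpen_image he hU
  have hd : ∀ q ∈ U, ContDiffAt ℝ ∞ f (τ q) := fun q hq ↦
    hf.contDiffAt (hS.mem_nhds (Set.mem_image_of_mem τ hq))
  have hfs : FunSmoothNear (2 * n + 2) (f ∘ τ) p := by
    filter_upwards [hU.mem_nhds hp] with q hq
    exact (hd q hq).contMDiffAt.comp q (hτ.contMDiffAt hU hq)
  have h1 : ∀ q ∈ U, ∀ a, mvfderiv (𝓡 (2 * n + 2)) (f ∘ τ) q (e.field a q) =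
      deriv f (τ q) * tauSign a := fun q hq a ↦ by
    rw [← hτ.mvfderiv_field he hq]
    exact hτ.mvfderiv_comp hU hq ((hd q hq).differentiableAt (by simp)) _
  have hdd : DifferentiableAt ℝ (deriv f) (τ p) :=
    ((hf.deriv_of_isOpen (m := 1) hS (by rw [one_add_one_eq_two]; exact ENat.LEInfty.out)).contDiffAt
      (hS.mem_nhds (Set.mem_image_of_mem τ hp))).differentiableAt (by simp)
  rw [ho.hessian_eq_sum hp hfs]
  refine Finset.sum_congr rfl fun b _ ↦ Finset.sum_congr rfl fun d _ ↦ ?_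
  have h2 : (fun q ↦ mvfderiv (𝓡 (2 * n + 2)) (f ∘ τ) q (e.field d q)) =ᶠ[𝓝 p]
      fun q ↦ deriv f (τ q) * tauSign d := by
    filter_upwards [hU.mem_nhds hp] with q hq using h1 q hq d
  rw [mvfderiv_congr h2, hτ.mvfderiv_comp (g := fun s ↦ deriv f s * tauSign d) hU hp
    (hdd.mul_const _), deriv_mul_const hdd, hτ.mvfderiv_field he hp]
  simp only [h1 p hp, he.conn_eq_gamma hU hp, FrameCoeffs.comp_gamma, mul_left_comm _ (deriv f _),
    ← Finset.mul_sum, sum_mul_tauSign, FrameCoeffs.hessCoeff]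
  ring

end Components

/-! ### Both soliton equations as systems of frame components -/

section Solitons
open VectorField Filter Topology FrameIndex IsOrthonormalFrameOn

set_option linter.unusedSectionVars false

namespace FrameIndex
variable {n : ℕ}

/-- The label `b'` with `J b = ± b'`. -/
def conj : FrameIndex n → FrameIndex n
  | k => t
  | t => k
  | x i => y i
  | y i => x i

/-- The sign in `J b = ± b'`. -/
def conjSign : FrameIndex n → ℝ
  | k => 1
  | t => -1
  | x _ => 1
  | y _ => -1

end FrameIndex

variable {n : ℕ} {M : Type*} [TopologicalSpace M]
  [ChartedSpace (EuclideanSpace ℝ (Fin (2 * n + 2))) M] [IsManifold (𝓡 (2 * n + 2)) ∞ M]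
  [RiemannianBundle (fun p : M ↦ TangentSpace (𝓡 (2 * n + 2)) p)]
  {U : Set M} {e : FrameFields n M} {τ : M → ℝ} {c : FrameCoeffs n ℝ} {p : M} {f : ℝ → ℝ}
  {lam : ℝ}

theorem IsKahlerFrameOn.J_field (he : IsKahlerFrameOn U e (c.comp τ)) (hp : p ∈ U)
    (b : FrameIndex n) : e.J p (e.field b p) = conjSign b • e.field (conj b) p := by
  have ho := orthonormal_iff_ite.1 (he.orthonormal_field hp)
  have hk := fun b ↦ ho k b
  have ht := fun b ↦ ho t b
  have hx := fun i b ↦ ho (x i) b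
  have hy := fun i b ↦ ho (y i) b
  simp only [FrameFields.field.eq_1, FrameFields.field.eq_2, FrameFields.field.eq_3,
    FrameFields.field.eq_4] at hk ht hx hy
  simp only [FrameFields.J, LinearMap.add_apply, LinearMap.sub_apply, LinearMap.sum_apply,
    LinearMap.smulRight_apply, innerₗ_apply_apply, hk, ht, hx, hy]
  cases b <;> simp [conj, conjSign, FrameFields.field]

/-- The bilinear form with given components in a frame. -/
def bilinAt (e : FrameFields n M) (p : M) (T : FrameIndex n → FrameIndex n → ℝ) :
    TangentSpace (𝓡 (2 * n + 2)) p →ₗ[ℝ] TangentSpace (𝓡 (2 * n + 2)) p →ₗ[ℝ] ℝ :=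
  ∑ b, ∑ d, T b d • (innerₗ _ (e.field b p)).smulRight (innerₗ _ (e.field d p))

theorem bilinAt_apply (T : FrameIndex n → FrameIndex n → ℝ)
    (u v : TangentSpace (𝓡 (2 * n + 2)) p) :
    bilinAt e p T u v =
      ∑ b, ∑ d, (inner ℝ (e.field b p) u * inner ℝ (e.field d p) v) * T b d := by
  simp only [bilinAt, LinearMap.sum_apply, LinearMap.smul_apply, LinearMap.smulRight_apply,
    innerₗ_apply_apply, smul_eq_mul, mul_comm (T _ _)]

theorem IsKahlerFrameOn.bilinAt_field (he : IsKahlerFrameOn U e (c.comp τ)) (hp : p ∈ U)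
    (T : FrameIndex n → FrameIndex n → ℝ) (b d : FrameIndex n) :
    bilinAt e p T (e.field b p) (e.field d p) = T b d := by
  have ho := orthonormal_iff_ite.1 (he.orthonormal_field hp)
  simp only [bilinAt_apply, mul_assoc, ← Finset.mul_sum]
  simp only [ho, ite_mul, one_mul, zero_mul, Finset.sum_ite_eq', Finset.mem_univ, if_true]

variable [IsContMDiffRiemannianBundle (𝓡 (2 * n + 2)) ∞ (EuclideanSpace ℝ (Fin (2 * n + 2)))
      (fun p : M ↦ TangentSpace (𝓡 (2 * n + 2)) p)]

theorem IsKahlerFrameOn.bilin_eq_iff (he : IsKahlerFrameOn U e (c.comp τ)) (hU : IsOpen U)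
    (hp : p ∈ U)
    (B B' : TangentSpace (𝓡 (2 * n + 2)) p →ₗ[ℝ] TangentSpace (𝓡 (2 * n + 2)) p →ₗ[ℝ] ℝ) :
    (∀ u v, B u v = B' u v) ↔
      ∀ b d, B (e.field b p) (e.field d p) = B' (e.field b p) (e.field d p) := by
  refine ⟨fun h b d ↦ h _ _, fun h u v ↦ ?_⟩
  have ho := he.isOrthonormalFrameOn hU
  rw [← ho.sum_inner_smul hp u, ← ho.sum_inner_smul hp v]
  simp only [map_sum, map_smul, LinearMap.sum_apply, LinearMap.smul_apply, h]

/-- The Ricci soliton equation in the frame. -/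
theorem IsTauOn.soliton_iff (hτ : IsTauOn U e τ) (hU : IsOpen U)
    (hc : c.SmoothOn (τ '' U)) (he : IsKahlerFrameOn U e (c.comp τ))
    (hf : ContDiffOn ℝ ∞ f (τ '' U)) (hp : p ∈ U) :
    (∀ u v : TangentSpace (𝓡 (2 * n + 2)) p,
        ricci p u v + hessian (f ∘ τ) p u v = lam * inner ℝ u v) ↔
      ∀ b d, (if b = d then c.ricciEigenvalue c.deriv (τ p) b else 0) + c.hessCoeff f (τ p) b d =
        if b = d then lam else 0 := by
  have ho := orthonormal_iff_ite.1 (he.orthonormal_field hp)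
  have h := he.bilin_eq_iff hU hp
    (bilinAt e p (fun b d ↦ if b = d then c.ricciEigenvalue c.deriv (τ p) b else 0)
      + bilinAt e p (c.hessCoeff f (τ p))) (lam • innerₗ _)
  simp only [LinearMap.add_apply, LinearMap.smul_apply, he.bilinAt_field hp, innerₗ_apply_apply,
    ho, smul_eq_mul, mul_ite, mul_one, mul_zero] at h
  rw [← h]
  simp only [hτ.ricci_eq hU hc he hp, hτ.hessian_eq hU he hf hp, bilinAt_apply]

/-- The Kähler-Ricci skew-soliton equation in the frame. -/
theorem IsTauOn.skewSoliton_iff (hτ : IsTauOn U e τ) (hU : IsOpen U)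
    (hc : c.SmoothOn (τ '' U)) (he : IsKahlerFrameOn U e (c.comp τ))
    (hf : ContDiffOn ℝ ∞ f (τ '' U)) (hp : p ∈ U) :
    (∀ u v : TangentSpace (𝓡 (2 * n + 2)) p,
        ricci p (e.J p u) v + (1 / 2 : ℝ) *
          (hessian (f ∘ τ) p (e.J p u) v - hessian (f ∘ τ) p (e.J p v) u) =
            lam * inner ℝ (e.J p u) v) ↔
      ∀ b d, conjSign b * (if conj b = d then c.ricciEigenvalue c.deriv (τ p) (conj b) else 0)
        + (1 / 2 : ℝ) * (conjSign b * c.hessCoeff f (τ p) (conj b) d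
          - conjSign d * c.hessCoeff f (τ p) (conj d) b) =
        lam * (conjSign b * if conj b = d then 1 else 0) := by
  have ho := orthonormal_iff_ite.1 (he.orthonormal_field hp)
  have h := he.bilin_eq_iff hU hp
    (bilinAt e p (fun b d ↦ if b = d then c.ricciEigenvalue c.deriv (τ p) b else 0) ∘ₗ e.J p
      + (1 / 2 : ℝ) • (bilinAt e p (c.hessCoeff f (τ p)) ∘ₗ e.J p
        - (bilinAt e p (c.hessCoeff f (τ p)) ∘ₗ e.J p).flip)) (lam • innerₗ _ ∘ₗ e.J p)
  simp only [LinearMap.add_apply, LinearMap.sub_apply, LinearMap.flip_apply, LinearMap.comp_apply,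
    LinearMap.smul_apply, he.J_field hp, map_smul, he.bilinAt_field hp,
    innerₗ_apply_apply, ho, smul_eq_mul] at h
  rw [← h]
  simp only [hτ.ricci_eq hU hc he hp, hτ.hessian_eq hU he hf hp, bilinAt_apply]

end Solitons

/-! ### Comparison of the component equations with the stated conditions -/

namespace FrameCoeffs
open FrameIndex Filter Topology
variable {n : ℕ} {c : FrameCoeffs n ℝ} {f : ℝ → ℝ} {lam s : ℝ} {S : Set ℝ}

/-- The skew-soliton equations of the ansatz. -/
def SkewEquations (c : FrameCoeffs n ℝ) (f : ℝ → ℝ) (lam s : ℝ) : Prop :=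
  c.deriv.psi s - c.L s * c.psi s + _root_.deriv (_root_.deriv f) s
      - _root_.deriv f s * c.L s = lam ∧
    ∀ i, -(c.N i s * (c.psi s + _root_.deriv f s)) = lam

/-- The soliton equations of the ansatz. -/
def SolitonEquations (c : FrameCoeffs n ℝ) (f : ℝ → ℝ) (lam s : ℝ) : Prop :=
  c.deriv.psi s - c.L s * c.psi s + _root_.deriv (_root_.deriv f) s
      - _root_.deriv f s * c.L s = lam ∧
    _root_.deriv (_root_.deriv f) s + c.L s * _root_.deriv f s = 0 ∧
    ∀ i, -(c.N i s * c.psi s) - _root_.deriv f s * (c.A i s - c.E i s) = lam ∧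
      -(c.N i s * c.psi s) - _root_.deriv f s * (c.D i s - c.H i s) = lam ∧
      _root_.deriv f s * (c.A i s + c.E i s) = 0 ∧ _root_.deriv f s * (c.D i s + c.H i s) = 0

/-- Antisymmetrising after J averages the Hessian entries over each J-invariant plane. On k, t both
entries are f'' - Lf'; on x_i, y_i the average of -f'(A_i - E_i) and -f'(D_i - H_i) is -f' N_i. -/
theorem LinearRelations.skewEquations_iff (h : c.LinearRelations s) :
    (∀ b d, conjSign b * (if conj b = d then c.ricciEigenvalue c.deriv s (conj b) else 0)
        + (1 / 2 : ℝ) * (conjSign b * c.hessCoeff f s (conj b) d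
          - conjSign d * c.hessCoeff f s (conj d) b) =
        lam * (conjSign b * if conj b = d then 1 else 0)) ↔ c.SkewEquations f lam s := by
  constructor
  · intro H
    refine ⟨?_, fun i ↦ ?_⟩
    · have := H k t
      simp only [conj, conjSign, if_true, ricciEigenvalue, hessCoeff, gamma, tauSign] at this
      linarith
    · have := H (x i) (y i)
      simp only [conj, conjSign, if_true, ricciEigenvalue, hessCoeff, gamma, tauSign] at this
      have h3 := h.rel_N i
      have h4 := h.rel_N' i
      have h5 : _root_.deriv f s * (2 * c.N i s) =
          _root_.deriv f s * (c.A i s + c.D i s - (c.E i s + c.H i s)) := by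
        congr 1; linarith
      linarith
  · rintro ⟨H1, H2⟩ b d
    cases b <;> cases d <;>
      simp only [conj, conjSign, ricciEigenvalue, hessCoeff, gamma, tauSign, reduceCtorEq,
        if_true, if_false, x.injEq, y.injEq]
    all_goals try linarith
    all_goals
      rename_i i j
      rcases eq_or_ne i j with rfl | hij
      · have h3 := h.rel_N i
        have h4 := h.rel_N' i
        have h5 : _root_.deriv f s * (2 * c.N i s) =
            _root_.deriv f s * (c.A i s + c.D i s - (c.E i s + c.H i s)) := by
          congr 1; linarith
        have h6 := H2 i
        simp only [if_true]
        linarith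
      · simp only [if_neg hij, if_neg hij.symm]
        ring

theorem solitonEquations_iff :
    (∀ b d, (if b = d then c.ricciEigenvalue c.deriv s b else 0) + c.hessCoeff f s b d =
        if b = d then lam else 0) ↔ c.SolitonEquations f lam s := by
  constructor
  · intro H
    refine ⟨?_, ?_, fun i ↦ ⟨?_, ?_, ?_, ?_⟩⟩
    · have := H k k
      simp only [if_true, ricciEigenvalue, hessCoeff, gamma, tauSign] at this
      linarith
    · have := H k t
      simp only [reduceCtorEq, if_false, hessCoeff, gamma, tauSign] at this
      linarith
    · have := H (x i) (x i)
      simp only [if_true, ricciEigenvalue, hessCoeff, gamma, tauSign] at this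
      linarith
    · have := H (y i) (y i)
      simp only [if_true, ricciEigenvalue, hessCoeff, gamma, tauSign] at this
      linarith
    · have := H (x i) (y i)
      simp only [reduceCtorEq, if_false, if_true, hessCoeff, gamma, tauSign] at this
      linarith
    · have := H (y i) (x i)
      simp only [reduceCtorEq, if_false, if_true, hessCoeff, gamma, tauSign] at this
      linarith
  · rintro ⟨H1, H2, H3⟩ b d
    cases b <;> cases d <;>
      simp only [ricciEigenvalue, hessCoeff, gamma, tauSign, reduceCtorEq,
        if_true, if_false, x.injEq, y.injEq]
    all_goals try linarith
    all_goals
      rename_i i j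
      rcases eq_or_ne i j with rfl | hij
      · obtain ⟨h1, h2, h3, h4⟩ := H3 i
        simp only [if_true]
        linarith
      · simp only [if_neg hij]
        ring

/-- The soliton equations are the skew-soliton equations together with the conditions that the
Hessian is compatible with the complex structure. -/
theorem LinearRelations.solitonEquations_iff_skewEquations (h : c.LinearRelations s) :
    c.SolitonEquations f lam s ↔ c.SkewEquations f lam s ∧
      (_root_.deriv f s ≠ 0 → _root_.deriv (_root_.deriv f) s + c.L s * _root_.deriv f s = 0 ∧
        ∀ i, c.A i s + c.E i s = 0 ∧ c.D i s + c.H i s = 0 ∧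
          c.B i s + c.C i s + c.F i s + c.G i s = 0) ∧
      (_root_.deriv f s = 0 → _root_.deriv (_root_.deriv f) s = 0) := by
  constructor
  · rintro ⟨H1, H2, H3⟩
    refine ⟨⟨H1, fun i ↦ ?_⟩, fun hf ↦ ⟨H2, fun i ↦ ?_⟩, fun hf ↦ ?_⟩
    · obtain ⟨h1, h2, -, -⟩ := H3 i
      have h3 := h.rel_N i
      have h4 := h.rel_N' i
      have h5 : _root_.deriv f s * (2 * c.N i s) =
          _root_.deriv f s * (c.A i s + c.D i s - (c.E i s + c.H i s)) := by
        congr 1; linarith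
      linarith
    · obtain ⟨h1, h2, h3, h4⟩ := H3 i
      -- The linear relations turn this sum into (A - E) - (D - H), and f' times that is the
      -- difference of the x_i, x_i and y_i, y_i equations.
      have h5 : _root_.deriv f s * (c.B i s + c.C i s + c.F i s + c.G i s) = 0 := by
        have h6 : c.B i s + c.C i s + c.F i s + c.G i s =
            c.A i s - c.D i s + (c.H i s - c.E i s) := by
          linarith [h.rel_AD i, h.rel_BC i]
        rw [h6]
        linarith
      exact ⟨(mul_eq_zero.1 h3).resolve_left hf, (mul_eq_zero.1 h4).resolve_left hf,
        (mul_eq_zero.1 h5).resolve_left hf⟩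
    · simpa [hf] using H2
  · rintro ⟨⟨H1, H2⟩, H3, H4⟩
    -- Where f' = 0 the Hessian is f'' dτ ⊗ dτ, and degeneracy kills it. Elsewhere the extra
    -- conditions hold and give A - E = D - H = N, so both diagonal equations reduce to the averaged
    -- one.
    rcases eq_or_ne (_root_.deriv f s) 0 with hf | hf
    · refine ⟨H1, by rw [H4 hf, hf]; ring, fun i ↦ ?_⟩
      have := H2 i
      rw [hf] at this ⊢
      simpa using this
    · obtain ⟨h1, h2⟩ := H3 hf
      refine ⟨H1, h1, fun i ↦ ?_⟩
      obtain ⟨h3, h4, h5⟩ := h2 i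
      have h6 := H2 i
      have h7 : c.A i s - c.E i s = c.N i s := by
        linarith [h.rel_AD i, h.rel_BC i, h.rel_N i, h.rel_N' i]
      have h8 : c.D i s - c.H i s = c.N i s := by
        linarith [h.rel_AD i, h.rel_BC i, h.rel_N i, h.rel_N' i]
      rw [h3, h4, h7, h8, mul_zero]
      exact ⟨by linarith, by linarith, rfl, rfl⟩

/-- The equations along x_i, y_i are equivalent to the stated conditions; the one along k, t is
recovered by differentiating them, which is why they are needed on an open set rather than at a
point. -/
theorem skewEquations_iff_skewSolitonODE (hn : 1 ≤ n) (hS : IsOpen S) (hc : c.SmoothOn S)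
    (hf : ContDiffOn ℝ ∞ f S) (hlam : lam ≠ 0)
    (h : ∀ s ∈ S, c.StructureEquations c.deriv s) :
    (∀ s ∈ S, c.SkewEquations f lam s) ↔ SkewSolitonODE c f lam S := by
  constructor
  · intro H
    refine ⟨c.N ⟨0, hn⟩, fun i s hs ↦ ?_, fun s hs ↦ ?_⟩
    · have h1 := (H s hs).2 i
      have h2 := (H s hs).2 ⟨0, hn⟩
      -- Since λ ≠ 0, neither factor of N_i(ψ + f') = -λ vanishes; cancelling the common factor ψ +
      -- f' shows that the N_i agree.
      have h3 : c.psi s + _root_.deriv f s ≠ 0 := fun h0 ↦ hlam (by rw [← h1, h0]; ring)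
      exact mul_right_cancel₀ h3 (by linarith)
    · have h1 := (H s hs).2 ⟨0, hn⟩
      have h2 : c.N ⟨0, hn⟩ s ≠ 0 := fun h0 ↦ hlam (by rw [← h1, h0]; ring)
      refine ⟨h2, ?_⟩
      rw [← psi, ← h1]
      field_simp
      ring
  · rintro ⟨N, hN, H⟩ s hs
    have key : ∀ r ∈ S, (c.psi r + _root_.deriv f r) * c.N ⟨0, hn⟩ r = -lam := fun r hr ↦ by
      obtain ⟨h1, h2⟩ := H r hr
      rw [← psi] at h2
      rw [h2, hN _ r hr]
      field_simp
      ring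
    have hdd : DifferentiableAt ℝ (_root_.deriv f) s :=
      ((hf.deriv_of_isOpen (m := 1) hS
        (by rw [one_add_one_eq_two]; exact ENat.LEInfty.out)).contDiffAt (hS.mem_nhds hs)).differentiableAt (by simp)
    have hd := hc.hasDerivAt hS hs
    -- The product (ψ + f')N is constant near `s`, so its derivative is zero; N' is then eliminated
    -- by `jacobi_kxy` and the factor N cancelled.
    have h1 := ((hd.psi.fun_add hdd.hasDerivAt).fun_mul (hd.N ⟨0, hn⟩)).unique <|
      (hasDerivAt_const s (-lam)).congr_of_eventuallyEq <| by
        filter_upwards [hS.mem_nhds hs] with r hr using key r hr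
    have h2 := (h s hs).jacobi_kxy ⟨0, hn⟩
    have h3 := key s hs
    have h4 : c.N ⟨0, hn⟩ s ≠ 0 := by
      rw [hN _ s hs]
      exact (H s hs).1
    refine ⟨mul_right_cancel₀ h4 ?_, fun i ↦ ?_⟩
    · linear_combination h1 - (c.psi s + _root_.deriv f s) * h2 - c.N ⟨0, hn⟩ s * h3
    · rw [hN i s hs, ← hN ⟨0, hn⟩ s hs]
      linarith

end FrameCoeffs
end

/-! ### The theorem: at each point the equations depend only on the value of τ -/

theorem proposition3p1 {n : ℕ} (hn : 1 ≤ n) {M : Type*} [TopologicalSpace M]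
    [ChartedSpace (EuclideanSpace ℝ (Fin (2 * n + 2))) M]
    [IsManifold (𝓡 (2 * n + 2)) ∞ M]
    [RiemannianBundle (fun p : M ↦ TangentSpace (𝓡 (2 * n + 2)) p)]
    [IsContMDiffRiemannianBundle (𝓡 (2 * n + 2)) ∞ (EuclideanSpace ℝ (Fin (2 * n + 2)))
      (fun p : M ↦ TangentSpace (𝓡 (2 * n + 2)) p)]
    (U : Set M) (hU : IsOpen U) (e : FrameFields n M)
    (τ : M → ℝ) (hτ : IsTauOn U e τ)
    (c : FrameCoeffs n ℝ) (hc : c.SmoothOn (τ '' U)) (he : IsKahlerFrameOn U e (c.comp τ))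
    (f : ℝ → ℝ) (hf : ContDiffOn ℝ ∞ f (τ '' U)) (lam : ℝ) (hlam : lam ≠ 0) :
    (IsGradientKahlerRicciSkewSolitonOn (d := 2 * n + 2) U e.J (f ∘ τ) lam ↔ SkewSolitonODE c f lam (τ '' U)) ∧
    (IsGradientRicciSolitonOn (d := 2 * n + 2) U (f ∘ τ) lam ↔
      SkewSolitonODE c f lam (τ '' U) ∧ SolitonConditions c f (τ '' U) ∧
        CriticalPointsDegenerate f (τ '' U)) := by
  have hS := hτ.isOpen_image he hU
  have hl : ∀ s ∈ τ '' U, c.LinearRelations s := fun s hs ↦ he.linearRelations_comp hs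
  have hs : ∀ s ∈ τ '' U, c.StructureEquations c.deriv s := by
    rintro _ ⟨p, hp, rfl⟩
    exact hτ.structureEquations hU hc he hp
  have hode := FrameCoeffs.skewEquations_iff_skewSolitonODE hn hS hc hf hlam hs
  constructor
  · rw [← hode, Set.forall_mem_image]
    exact forall₂_congr fun p hp ↦ (hτ.skewSoliton_iff hU hc he hf hp).trans
      (hl _ (Set.mem_image_of_mem τ hp)).skewEquations_iff
  · have h1 : IsGradientRicciSolitonOn (d := 2 * n + 2) U (f ∘ τ) lam ↔
        ∀ s ∈ τ '' U, c.SolitonEquations f lam s := by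
      rw [Set.forall_mem_image]
      exact forall₂_congr fun p hp ↦ (hτ.soliton_iff hU hc he hf hp).trans
        FrameCoeffs.solitonEquations_iff
    rw [h1, ← hode, SolitonConditions, CriticalPointsDegenerate]
    simp only [← forall₂_and]
    exact forall₂_congr fun s hs ↦ (hl s hs).solitonEquations_iff_skewEquations
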